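/- Let $n\ge 5$ and let $Q(X)=A_1X_1^2+\cdots+A_nX_n^2$ be a diagonal quadratic form with integer coefficients that is indefinite, i.e. takes both positive and negative values on $\mathbb{R}^n$. Put $\|Q\|=\max_i|A_i|$ and $|\mathbf{x}|=\max_i|x_i|$. Then there is a nonzero $\mathbf{x}\in\mathbb{Z}^n$ with $Q(\mathbf{x})=0$ and $$|\mathbf{x}|\le\sqrt{2}\,\|Q\|^2.$$ Equivalently, $Q$ has a nontrivial integral zero and $\Lambda_n(Q)\le\sqrt{2}\,\|Q\|^2$, where $\Lambda_n(Q)$ is the least non-negative real number such that, if $Q$ has a nontrivial integral zero, then it has one with $|\mathbf{x}|\le\Lambda_n(Q)$. -/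

import Mathlib

namespace IntegralForm

/-- The quadratic form `x ↦ xᵀ A x` on `ℤⁿ` with integral matrix `A`. -/
def form {n : ℕ} (A : Matrix (Fin n) (Fin n) ℤ) : QuadraticForm ℤ (Fin n → ℤ) :=
  A.toQuadraticForm'

/-- The quadratic form `x ↦ xᵀ A x` on `ℝⁿ` with integral matrix `A`. -/
noncomputable def realForm {n : ℕ} (A : Matrix (Fin n) (Fin n) ℤ) :
    QuadraticForm ℝ (Fin n → ℝ) :=
  (A.map (Int.cast : ℤ → ℝ)).toQuadraticForm'

/-- The form with matrix `A` is indefinite: over `ℝ` it takes positive and negative values. -/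
def Indefinite {n : ℕ} (A : Matrix (Fin n) (Fin n) ℤ) : Prop :=
  (∃ x, 0 < realForm A x) ∧ ∃ y, realForm A y < 0

/-- The height: the largest absolute value of an entry of the matrix `A`. -/
def height {n : ℕ} (A : Matrix (Fin n) (Fin n) ℤ) : ℕ :=
  Finset.univ.sup fun p : Fin n × Fin n => (A p.1 p.2).natAbs

/-- The set of nontrivial integral zeros of the form with matrix `A`. -/
def zeros {n : ℕ} (A : Matrix (Fin n) (Fin n) ℤ) : Set (Fin n → ℤ) :=
  {x | x ≠ 0 ∧ form A x = 0}

/-- The least `B ≥ 0` such that, if the form with matrix `A` has a nontrivial integral zero, then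
it has one of sup norm at most `B`. (The norm on `Fin n → ℤ` is the maximum norm.) -/
noncomputable def leastZeroBound {n : ℕ} (A : Matrix (Fin n) (Fin n) ℤ) : ℝ :=
  sInf {B : ℝ | 0 ≤ B ∧ ((zeros A).Nonempty → ∃ x ∈ zeros A, ‖x‖ ≤ B)}

end IntegralForm

/-! If some coefficient vanishes, a unit vector is a zero. Otherwise five indices including a
positive and a negative coefficient are chosen and the remaining variables set to zero, so
everything reduces to five nonzero coefficients `c i` of both signs.

Existence is Meyer's theorem (`meyer_five`). One looks for integers `t`, `s` such that `t` is
represented by `⟨c 0, c 1⟩`, `s` by `⟨c 2, c 3⟩`, and `-c 4` by `⟨t, s⟩`; three conics must then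
have points. Legendre's descent (`conicSolvable_of_oddSymbol`) reduces each to local symbols.
Suitable square classes of `t` and `s` exist at every place, the real one using indefiniteness, and
Dirichlet's theorem realises finitely many of them by integers with one uncontrolled prime. The
product formula (`symbolSum_eq_zero`), which is quadratic reciprocity, takes care of that prime.

For the size, let `a` be a zero minimising the majorant `∑ |c i| x i ^ 2`, with minimum `T`. For `x`
independent of `a` with `Q(x)` even, the reflection of `a` in `x`, suitably scaled, is another
integral zero, and minimality of `a` bounds `x` below: in the form "majorant plus `(∑ c i a i x i)²
/ T`", projected along `a`, its value is at least `2` (`two_le_of_minimal`, where `T ≥ 3` is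
assumed). Vectors with `Q` even form a lattice of index at most two. Hermite's inequality on its
four-dimensional projection (`IsPos.hermite_le_det`) compares this minimum with a determinant of at
most `8 ∏ |c i| / T`, whence `T ≤ 4 ∏ |c i|`. Since `Q(a) = 0`, each `|c i| a i ^ 2` is at most `T /
2`, so `a i ^ 2` is at most twice the product of the other four `|c j|`. -/

namespace HilbertSymbol

/-! Hilbert symbols over `ℚ`, written additively with values in `ZMod 2`. -/

/-- The part of `a` prime to `p`. -/
def unitPart (p : ℕ) (a : ℤ) : ℤ := a / (p : ℤ) ^ padicValInt p a

/-- The quadratic residue character modulo `p`, written additively. -/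
def resBit (p : ℕ) (u : ℤ) : ZMod 2 := if jacobiSym u p = 1 then 0 else 1

/-- The class of `a` in the square class group of `ℚ_p`, for odd `p`. -/
def oddCls (p : ℕ) (a : ℤ) : ZMod 2 × ZMod 2 := ((padicValInt p a : ZMod 2), resBit p (unitPart p a))

/-- The Hilbert pairing on square classes at an odd prime, where `e` is the class of `-1`. -/
def oddPair (e : ZMod 2) (x y : ZMod 2 × ZMod 2) : ZMod 2 := e * x.1 * y.1 + x.2 * y.1 + y.2 * x.1

/-- The Hilbert symbol at an odd prime. -/
def oddSymbol (p : ℕ) (a b : ℤ) : ZMod 2 := oddPair (resBit p (-1)) (oddCls p a) (oddCls p b)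

/-- The character modulo `4`, written additively. -/
def epsBit (u : ℤ) : ZMod 2 := if u % 4 = 1 then 0 else 1

/-- The character of `2` modulo `8`, written additively. -/
def omegaBit (u : ℤ) : ZMod 2 := if u % 8 = 1 ∨ u % 8 = 7 then 0 else 1

/-- The class of `a` in the square class group of `ℚ_2`. -/
def twoCls (a : ℤ) : ZMod 2 × ZMod 2 × ZMod 2 :=
  ((padicValInt 2 a : ZMod 2), epsBit (unitPart 2 a), omegaBit (unitPart 2 a))

/-- The Hilbert pairing on square classes at `2`. -/
def twoPair (x y : ZMod 2 × ZMod 2 × ZMod 2) : ZMod 2 :=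
  x.2.1 * y.2.1 + x.1 * y.2.2 + x.2.2 * y.1

/-- The Hilbert symbol at `2`. -/
def twoSymbol (a b : ℤ) : ZMod 2 := twoPair (twoCls a) (twoCls b)

/-- The sign of `a`, written additively. -/
def signBit (a : ℤ) : ZMod 2 := if a < 0 then 1 else 0

/-- The Hilbert symbol at infinity. -/
def realSymbol (a b : ℤ) : ZMod 2 := signBit a * signBit b

/-! ### Square classes and bilinearity of the local symbols. -/

theorem exists_eq_pow_mul (p : ℕ) (hp : p.Prime) {a : ℤ} (ha : a ≠ 0) :
    ∃ (k : ℕ) (u : ℤ), a = (p : ℤ) ^ k * u ∧ ¬ (p : ℤ) ∣ u := by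
  have hf : FiniteMultiplicity (p : ℤ) a := by
    rw [Int.finiteMultiplicity_iff]
    exact ⟨by simpa using hp.one_lt.ne', ha⟩
  obtain ⟨c, h1, h2⟩ := hf.exists_eq_pow_mul_and_not_dvd
  exact ⟨_, c, h1, h2⟩

theorem padicValInt_pow_mul {p : ℕ} (hp : p.Prime) (k : ℕ) {u : ℤ} (hu : ¬ (p : ℤ) ∣ u) :
    padicValInt p ((p : ℤ) ^ k * u) = k := by
  have := Fact.mk hp
  have hu0 : u ≠ 0 := by rintro rfl; simp at hu
  have hp0 : (p : ℤ) ^ k ≠ 0 := pow_ne_zero _ (by exact_mod_cast hp.ne_zero)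
  rw [padicValInt.mul hp0 hu0, padicValInt.eq_zero_of_not_dvd hu]
  simp [padicValInt, Int.natAbs_pow]

theorem unitPart_pow_mul {p : ℕ} (hp : p.Prime) (k : ℕ) {u : ℤ} (hu : ¬ (p : ℤ) ∣ u) :
    unitPart p ((p : ℤ) ^ k * u) = u := by
  rw [unitPart, padicValInt_pow_mul hp k hu]
  exact Int.mul_ediv_cancel_left _ (pow_ne_zero _ (by exact_mod_cast hp.ne_zero))

theorem oddCls_pow_mul {p : ℕ} (hp : p.Prime) (k : ℕ) {u : ℤ} (hu : ¬ (p : ℤ) ∣ u) :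
    oddCls p ((p : ℤ) ^ k * u) = ((k : ZMod 2), resBit p u) := by
  rw [oddCls, padicValInt_pow_mul hp k hu, unitPart_pow_mul hp k hu]

theorem oddCls_unit {p : ℕ} (hp : p.Prime) {u : ℤ} (hu : ¬ (p : ℤ) ∣ u) :
    oddCls p u = (0, resBit p u) := by
  simpa using oddCls_pow_mul hp 0 hu

theorem twoCls_pow_mul (k : ℕ) {u : ℤ} (hu : ¬ (2 : ℤ) ∣ u) :
    twoCls ((2 : ℤ) ^ k * u) = ((k : ZMod 2), epsBit u, omegaBit u) := by
  have h1 := padicValInt_pow_mul Nat.prime_two k hu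
  have h2 := unitPart_pow_mul Nat.prime_two k hu
  rw [Nat.cast_ofNat] at h1 h2
  rw [twoCls, h1, h2]

theorem twoCls_unit {u : ℤ} (hu : ¬ (2 : ℤ) ∣ u) : twoCls u = (0, epsBit u, omegaBit u) := by
  simpa using twoCls_pow_mul 0 hu

theorem not_dvd_mul {p : ℕ} (hp : p.Prime) {u v : ℤ} (hu : ¬ (p : ℤ) ∣ u) (hv : ¬ (p : ℤ) ∣ v) :
    ¬ (p : ℤ) ∣ u * v := fun h =>
  ((Nat.prime_iff_prime_int.mp hp).dvd_or_dvd h).elim hu hv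

theorem jacobiSym_eq_one_or {p : ℕ} (hp : p.Prime) {u : ℤ} (hu : ¬ (p : ℤ) ∣ u) :
    jacobiSym u p = 1 ∨ jacobiSym u p = -1 := by
  have := Fact.mk hp
  rw [← jacobiSym.legendreSym.to_jacobiSym]
  exact legendreSym.eq_one_or_neg_one p (by rwa [Ne, ZMod.intCast_zmod_eq_zero_iff_dvd])

theorem resBit_mul {p : ℕ} (hp : p.Prime) {u v : ℤ} (hu : ¬ (p : ℤ) ∣ u) (hv : ¬ (p : ℤ) ∣ v) :
    resBit p (u * v) = resBit p u + resBit p v := by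
  unfold resBit
  rw [jacobiSym.mul_left]
  rcases jacobiSym_eq_one_or hp hu with h | h <;> rcases jacobiSym_eq_one_or hp hv with h' | h' <;>
    rw [h, h'] <;> decide

theorem resBit_eq_zero_iff {p : ℕ} (hp : p.Prime) {u : ℤ} (hu : ¬ (p : ℤ) ∣ u) :
    resBit p u = 0 ↔ IsSquare (u : ZMod p) := by
  have := Fact.mk hp
  rw [← legendreSym.eq_one_iff p (a := u) (by rwa [Ne, ZMod.intCast_zmod_eq_zero_iff_dvd]),
    jacobiSym.legendreSym.to_jacobiSym]
  unfold resBit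
  split_ifs with h <;> simp [h]

theorem resBit_congr {p : ℕ} {u v : ℤ} (h : u ≡ v [ZMOD p]) : resBit p u = resBit p v := by
  unfold resBit
  rw [jacobiSym.mod_left u, jacobiSym.mod_left v, h]

theorem resBit_one (p : ℕ) : resBit p 1 = 0 := by simp [resBit]

theorem oddCls_mul {p : ℕ} (hp : p.Prime) {a b : ℤ} (ha : a ≠ 0) (hb : b ≠ 0) :
    oddCls p (a * b) = oddCls p a + oddCls p b := by
  obtain ⟨k, u, rfl, hu⟩ := exists_eq_pow_mul p hp ha
  obtain ⟨l, v, rfl, hv⟩ := exists_eq_pow_mul p hp hb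
  rw [show (p : ℤ) ^ k * u * ((p : ℤ) ^ l * v) = (p : ℤ) ^ (k + l) * (u * v) by ring,
    oddCls_pow_mul hp _ (not_dvd_mul hp hu hv), oddCls_pow_mul hp _ hu, oddCls_pow_mul hp _ hv,
    resBit_mul hp hu hv]
  simp

theorem epsBit_mul {u v : ℤ} (hu : ¬ (2 : ℤ) ∣ u) (hv : ¬ (2 : ℤ) ∣ v) :
    epsBit (u * v) = epsBit u + epsBit v := by
  have h1 : u % 4 = 1 ∨ u % 4 = 3 := by omega
  have h2 : v % 4 = 1 ∨ v % 4 = 3 := by omega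
  unfold epsBit
  rw [Int.mul_emod]
  rcases h1 with h1 | h1 <;> rcases h2 with h2 | h2 <;> rw [h1, h2] <;> decide

theorem omegaBit_mul {u v : ℤ} (hu : ¬ (2 : ℤ) ∣ u) (hv : ¬ (2 : ℤ) ∣ v) :
    omegaBit (u * v) = omegaBit u + omegaBit v := by
  have h1 : u % 8 = 1 ∨ u % 8 = 3 ∨ u % 8 = 5 ∨ u % 8 = 7 := by omega
  have h2 : v % 8 = 1 ∨ v % 8 = 3 ∨ v % 8 = 5 ∨ v % 8 = 7 := by omega
  unfold omegaBit
  rw [Int.mul_emod]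
  rcases h1 with h1 | h1 | h1 | h1 <;> rcases h2 with h2 | h2 | h2 | h2 <;> rw [h1, h2] <;> decide

theorem twoCls_mul {a b : ℤ} (ha : a ≠ 0) (hb : b ≠ 0) :
    twoCls (a * b) = twoCls a + twoCls b := by
  obtain ⟨k, u, rfl, hu⟩ := exists_eq_pow_mul 2 Nat.prime_two ha
  obtain ⟨l, v, rfl, hv⟩ := exists_eq_pow_mul 2 Nat.prime_two hb
  have huv := not_dvd_mul Nat.prime_two hu hv
  rw [Nat.cast_ofNat] at *
  rw [show (2 : ℤ) ^ k * u * ((2 : ℤ) ^ l * v) = (2 : ℤ) ^ (k + l) * (u * v) by ring,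
    twoCls_pow_mul _ huv, twoCls_pow_mul _ hu, twoCls_pow_mul _ hv, epsBit_mul hu hv,
    omegaBit_mul hu hv]
  simp

theorem signBit_mul {a b : ℤ} (ha : a ≠ 0) (hb : b ≠ 0) :
    signBit (a * b) = signBit a + signBit b := by
  have h11 : (0 : ZMod 2) = 1 + 1 := by decide
  unfold signBit
  rcases lt_or_gt_of_ne ha with h | h <;> rcases lt_or_gt_of_ne hb with h' | h'
  · rw [if_pos h, if_pos h', if_neg (mul_pos_of_neg_of_neg h h').not_gt, h11]
  · rw [if_pos h, if_neg h'.not_gt, if_pos (mul_neg_of_neg_of_pos h h'), add_zero]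
  · rw [if_neg h.not_gt, if_pos h', if_pos (mul_neg_of_pos_of_neg h h'), zero_add]
  · rw [if_neg h.not_gt, if_neg h'.not_gt, if_neg (mul_pos h h').not_gt, zero_add]

theorem oddPair_add_left (e : ZMod 2) (x x' y : ZMod 2 × ZMod 2) :
    oddPair e (x + x') y = oddPair e x y + oddPair e x' y := by
  simp only [oddPair, Prod.fst_add, Prod.snd_add]; ring

theorem oddPair_comm (e : ZMod 2) (x y : ZMod 2 × ZMod 2) : oddPair e x y = oddPair e y x := by
  simp only [oddPair]; ring

theorem twoPair_add_left (x x' y : ZMod 2 × ZMod 2 × ZMod 2) :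
    twoPair (x + x') y = twoPair x y + twoPair x' y := by
  simp only [twoPair, Prod.fst_add, Prod.snd_add]; ring

theorem twoPair_comm (x y : ZMod 2 × ZMod 2 × ZMod 2) : twoPair x y = twoPair y x := by
  simp only [twoPair]; ring

theorem oddSymbol_mul_left {p : ℕ} (hp : p.Prime) {a a' : ℤ} (ha : a ≠ 0) (ha' : a' ≠ 0) (b : ℤ) :
    oddSymbol p (a * a') b = oddSymbol p a b + oddSymbol p a' b := by
  rw [oddSymbol, oddCls_mul hp ha ha', oddPair_add_left]; rfl

theorem oddSymbol_comm (p : ℕ) (a b : ℤ) : oddSymbol p a b = oddSymbol p b a := oddPair_comm _ _ _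

theorem oddSymbol_mul_right {p : ℕ} (hp : p.Prime) {b b' : ℤ} (hb : b ≠ 0) (hb' : b' ≠ 0) (a : ℤ) :
    oddSymbol p a (b * b') = oddSymbol p a b + oddSymbol p a b' := by
  rw [oddSymbol_comm, oddSymbol_mul_left hp hb hb', oddSymbol_comm p b, oddSymbol_comm p b']

theorem oddSymbol_unit {p : ℕ} (hp : p.Prime) {a b : ℤ} (ha : ¬ (p : ℤ) ∣ a) (hb : ¬ (p : ℤ) ∣ b) :
    oddSymbol p a b = 0 := by
  simp [oddSymbol, oddCls_unit hp ha, oddCls_unit hp hb, oddPair]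

theorem zmod_two_add_self (x : ZMod 2) : x + x = 0 := CharTwo.add_self_eq_zero x

theorem oddSymbol_mul_sq {p : ℕ} (hp : p.Prime) {b c : ℤ} (hb : b ≠ 0) (hc : c ≠ 0) (a : ℤ) :
    oddSymbol p a (c ^ 2 * b) = oddSymbol p a b := by
  rw [oddSymbol_mul_right hp (pow_ne_zero 2 hc) hb, sq, oddSymbol_mul_right hp hc hc,
    zmod_two_add_self, zero_add]

/-- If `a + b` is a square, the symbol of `a` and `b` is trivial. -/
theorem oddSymbol_eq_zero_of_add_eq_sq {p : ℕ} (hp : p.Prime) {a b c : ℤ} (ha : a ≠ 0)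
    (hb : b ≠ 0) (h : a + b = c ^ 2) : oddSymbol p a b = 0 := by
  have hpp : Prime (p : ℤ) := Nat.prime_iff_prime_int.mp hp
  -- When the valuations differ, the term of smaller valuation has the valuation and leading unit of
  -- `c ^ 2`, so its square class is trivial.
  have aux : ∀ (k j : ℕ) (u v : ℤ), ¬ (p : ℤ) ∣ u → ¬ (p : ℤ) ∣ v →
      (p : ℤ) ^ k * u + (p : ℤ) ^ (k + (j + 1)) * v = c ^ 2 →
      (k : ZMod 2) = 0 ∧ resBit p u = 0 := by
    intro k j u v hu hv h
    have h1 : c ^ 2 = (p : ℤ) ^ k * (u + p * (p ^ j * v)) := by rw [← h]; ring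
    have hw : ¬ (p : ℤ) ∣ u + p * (p ^ j * v) := fun h' =>
      hu ((Int.dvd_add_left (Dvd.intro _ rfl)).mp h')
    have hc : c ≠ 0 := by
      rintro rfl
      have : u + p * (p ^ j * v) = 0 := by
        rcases mul_eq_zero.mp (h1.symm.trans (by norm_num)) with h' | h'
        · exact absurd h' (pow_ne_zero _ hpp.ne_zero)
        · exact h'
      exact hw (this ▸ dvd_zero _)
    obtain ⟨m, w, rfl, hw'⟩ := exists_eq_pow_mul p hp hc
    have h2 : ((p : ℤ) ^ m * w) ^ 2 = (p : ℤ) ^ (m + m) * (w * w) := by ring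
    have h3 := congrArg (oddCls p) (h2.symm.trans h1)
    rw [oddCls_pow_mul hp _ hw, oddCls_pow_mul hp _ (not_dvd_mul hp hw' hw'), resBit_mul hp hw' hw',
      zmod_two_add_self, Nat.cast_add, zmod_two_add_self] at h3
    have h4 := Prod.ext_iff.mp h3
    refine ⟨h4.1.symm, ?_⟩
    rw [resBit_congr (v := u + p * (p ^ j * v))]
    · exact h4.2.symm
    · exact (Int.modEq_iff_dvd).mpr ⟨p ^ j * v, by ring⟩
  obtain ⟨k, u, rfl, hu⟩ := exists_eq_pow_mul p hp ha
  obtain ⟨l, v, rfl, hv⟩ := exists_eq_pow_mul p hp hb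
  rw [oddSymbol, oddCls_pow_mul hp _ hu, oddCls_pow_mul hp _ hv]
  simp only [oddPair]
  rcases lt_trichotomy k l with hkl | hkl | hkl
  · obtain ⟨j, rfl⟩ := Nat.exists_eq_add_of_lt hkl
    obtain ⟨h1, h2⟩ := aux k j u v hu hv (by rw [← add_assoc]; exact h)
    rw [h1, h2]; ring
  · subst hkl
    rcases Nat.even_or_odd k with hk | hk
    · have : (k : ZMod 2) = 0 := (ZMod.natCast_eq_zero_iff_even).mpr hk
      rw [this]; ring
    -- For equal odd valuations, `u + v` must be divisible by `p`, since `c ^ 2` has even valuation;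
    -- then `-u * v` is a square modulo `p`.
    · have h1 : (k : ZMod 2) = 1 := (ZMod.natCast_eq_one_iff_odd).mpr hk
      have hd : (p : ℤ) ∣ u + v := by
        by_contra hd
        have hc : c ≠ 0 := by
          rintro rfl
          rw [← mul_add] at h
          rcases mul_eq_zero.mp (h.trans (by norm_num)) with h' | h'
          · exact pow_ne_zero _ hpp.ne_zero h'
          · exact hd (h' ▸ dvd_zero _)
        obtain ⟨m, w, rfl, hw'⟩ := exists_eq_pow_mul p hp hc
        have h2 : (p : ℤ) ^ k * (u + v) = (p : ℤ) ^ (m + m) * (w * w) := by linear_combination h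
        have h3 := congrArg (padicValInt p) h2
        rw [padicValInt_pow_mul hp _ hd, padicValInt_pow_mul hp _ (not_dvd_mul hp hw' hw')] at h3
        obtain ⟨r, hr⟩ := hk
        omega
      have hn : ¬ (p : ℤ) ∣ -1 := by
        rw [dvd_neg]; exact hpp.not_dvd_one
      have h3 : resBit p (-1 * (u * v)) = 0 := by
        rw [resBit_eq_zero_iff hp (not_dvd_mul hp hn (not_dvd_mul hp hu hv))]
        have : (v : ZMod p) = -u := by
          have := (ZMod.intCast_zmod_eq_zero_iff_dvd (u + v) p).mpr hd
          push_cast at this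
          linear_combination this
        exact ⟨u, by push_cast; rw [this]; ring⟩
      rw [resBit_mul hp hn (not_dvd_mul hp hu hv), resBit_mul hp hu hv] at h3
      rw [h1]; linear_combination h3
  · obtain ⟨j, rfl⟩ := Nat.exists_eq_add_of_lt hkl
    obtain ⟨h1, h2⟩ := aux l j v u hv hu (by rw [← add_assoc, add_comm]; exact h)
    rw [h1, h2]; ring

/-! ### Legendre's theorem on conics. -/

/-- The conic `z² = a x² + b y²` has a nontrivial integral point. -/
def ConicSolvable (a b : ℤ) : Prop :=
  ∃ x y z : ℤ, (x ≠ 0 ∨ y ≠ 0 ∨ z ≠ 0) ∧ z ^ 2 = a * x ^ 2 + b * y ^ 2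

theorem ConicSolvable.symm {a b : ℤ} (h : ConicSolvable a b) : ConicSolvable b a := by
  obtain ⟨x, y, z, h0, h⟩ := h
  exact ⟨y, x, z, by tauto, by rw [h, add_comm]⟩

theorem ConicSolvable.mul_sq {a b : ℤ} (h : ConicSolvable a b) {c : ℤ} (hc : c ≠ 0) :
    ConicSolvable a (c ^ 2 * b) := by
  obtain ⟨x, y, z, h0, h⟩ := h
  refine ⟨c * x, y, c * z, ?_, by linear_combination c ^ 2 * h⟩
  simpa [hc] using h0

/-- Norms from `ℚ(√a)` multiply: the new point comes from `(z + x√a)(t + √a)`, whose norm is `b' y²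
· b b' = b (b' y)²`. -/
theorem ConicSolvable.of_norm {a b b' t : ℤ} (h : ConicSolvable a b') (hb' : b' ≠ 0) (hb : b ≠ 0)
    (ht : t ^ 2 - a = b * b') : ConicSolvable a b := by
  obtain ⟨x, y, z, h0, h⟩ := h
  refine ⟨z + x * t, b' * y, z * t + a * x, ?_, by
    linear_combination (t ^ 2 - a) * h + b' * y ^ 2 * ht⟩
  by_contra! hcon
  obtain ⟨h1, h2, h3⟩ := hcon
  have hy : y = 0 := by simpa [hb'] using h2
  have hx : x = 0 := by
    have : x * (b * b') = 0 := by rw [← ht]; linear_combination t * h1 - h3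
    simpa [hb, hb'] using this
  have hz : z = 0 := by simpa [hx] using h1
  tauto

theorem isSquare_zmod_of_squarefree (a : ℤ) (n : ℕ) (hn : Squarefree n)
    (h : ∀ p : ℕ, p.Prime → p ∣ n → IsSquare (a : ZMod p)) : IsSquare (a : ZMod n) := by
  induction n using induction_on_primes with
  | zero => exact absurd hn not_squarefree_zero
  | one => exact ⟨0, Subsingleton.elim _ _⟩
  | prime_mul p m hp ih =>
    have hc : p.Coprime m := Nat.coprime_of_squarefree_mul hn
    have h1 := ih (hn.squarefree_of_dvd (Dvd.intro_left _ rfl))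
      (fun q hq hqm => h q hq (hqm.mul_left p))
    have h2 := h p hp (Dvd.intro _ rfl)
    obtain ⟨x, hx⟩ := h2
    obtain ⟨y, hy⟩ := h1
    have h3 : IsSquare (a : ZMod p × ZMod m) :=
      ⟨(x, y), by ext <;> simp [hx, hy]⟩
    simpa using h3.map (ZMod.chineseRemainder hc).symm

/-- The balanced representative of a square root of `a` modulo `b` makes the cofactor `b'` small;
this drives the descent. -/
theorem exists_sq_sub_eq_mul {a b : ℤ} (hb : Squarefree b)
    (h : ∀ p : ℕ, p.Prime → (p : ℤ) ∣ b → IsSquare (a : ZMod p)) :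
    ∃ t b' : ℤ, t ^ 2 - a = b * b' ∧ 4 * t ^ 2 ≤ b ^ 2 := by
  have hb0 : b ≠ 0 := hb.ne_zero
  obtain ⟨r, hr⟩ := isSquare_zmod_of_squarefree a b.natAbs (Int.squarefree_natAbs.mpr hb)
    (fun p hp hpb => h p hp (Int.natCast_dvd.mpr hpb))
  obtain ⟨s, rfl⟩ := ZMod.intCast_surjective r
  have hpos : 0 < b.natAbs := Int.natAbs_pos.mpr hb0
  obtain ⟨k, hk⟩ : (b.natAbs : ℤ) ∣ s - Int.bmod s b.natAbs :=
    Int.dvd_self_sub_bmod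
  set t := Int.bmod s b.natAbs with ht
  have hts : (t : ZMod b.natAbs) = s := by
    have := (ZMod.intCast_zmod_eq_zero_iff_dvd (s - t) b.natAbs).mpr ⟨k, hk⟩
    push_cast at this
    linear_combination -this
  have hd : (b.natAbs : ℤ) ∣ t ^ 2 - a := by
    rw [← ZMod.intCast_zmod_eq_zero_iff_dvd]
    push_cast
    rw [hts, hr]; ring
  obtain ⟨b', hb'⟩ := Int.natAbs_dvd.mp hd
  refine ⟨t, b', hb', ?_⟩
  have h1 : 2 * t ≤ b.natAbs := by
    have := Int.bmod_le (x := s) hpos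
    omega
  have h2 : -(b.natAbs : ℤ) ≤ 2 * t := by
    have := Int.le_bmod (x := s) hpos
    omega
  have h3 : |2 * t| ≤ |b| := by
    rw [Int.abs_eq_natAbs b]; exact abs_le.mpr ⟨h2, h1⟩
  have h4 := sq_le_sq.mpr h3
  linarith [h4, mul_pow 2 t 2]

theorem exists_sq_mul_squarefree {b : ℤ} (hb : b ≠ 0) :
    ∃ c d : ℤ, b = c ^ 2 * d ∧ Squarefree d ∧ c ≠ 0 := by
  obtain ⟨d, c, h, hd⟩ := Nat.sq_mul_squarefree b.natAbs
  refine ⟨c, b.sign * d, ?_, ?_, ?_⟩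
  · calc b = b.sign * b.natAbs := (Int.sign_mul_natAbs b).symm
      _ = _ := by rw [← h]; push_cast; ring
  · rw [← Int.squarefree_natAbs, Int.natAbs_mul, Int.natAbs_sign_of_ne_zero hb]
    simpa using hd
  · rintro h0
    have : c = 0 := by exact_mod_cast h0
    rw [this] at h
    simp at h
    omega

/-- Since `b` is squarefree, `p` divides it exactly once, and for `p` odd and prime to `a` the
symbol is the residue character of `a`. Modulo `2` everything is a square, so that prime imposes
nothing. -/
theorem isSquare_of_oddSymbol_eq_zero {a b : ℤ} (hb : Squarefree b)
    (h : ∀ p : ℕ, p.Prime → p ≠ 2 → oddSymbol p a b = 0) (p : ℕ) (hp : p.Prime)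
    (hpb : (p : ℤ) ∣ b) : IsSquare (a : ZMod p) := by
  rcases eq_or_ne p 2 with rfl | hp2
  · generalize (a : ZMod 2) = x
    revert x; decide
  by_cases hpa : (p : ℤ) ∣ a
  · rw [(ZMod.intCast_zmod_eq_zero_iff_dvd a p).mpr hpa]
    exact IsSquare.zero
  rw [← resBit_eq_zero_iff hp hpa]
  have h1 := h p hp hp2
  obtain ⟨c, rfl⟩ := hpb
  have hc : ¬ (p : ℤ) ∣ c := by
    rintro ⟨d, rfl⟩
    have := hb p ⟨d, by ring⟩
    exact (Nat.prime_iff_prime_int.mp hp).not_isUnit this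
  have h2 := oddCls_pow_mul hp 1 hc
  rw [pow_one] at h2
  rw [oddSymbol, h2, oddCls_unit hp hpa] at h1
  simpa [oddPair] using h1

/-- Legendre's theorem: no condition at the prime `2` is needed. -/
theorem conicSolvable_of_oddSymbol {a b : ℤ} (ha : a ≠ 0) (hb : b ≠ 0) (hpos : 0 < a ∨ 0 < b)
    (h : ∀ p : ℕ, p.Prime → p ≠ 2 → oddSymbol p a b = 0) : ConicSolvable a b := by
  induction hn : a.natAbs + b.natAbs using Nat.strong_induction_on generalizing a b with
  | _ n ih =>
  subst hn
  wlog hab : a.natAbs ≤ b.natAbs generalizing a b with H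
  · refine (H hb ha hpos.symm (fun p hp hp2 => by rw [oddSymbol_comm, h p hp hp2]) ?_
      (le_of_not_ge hab)).symm
    intro m hm a' b' ha' hb' hpos' h' hm'
    exact ih m (by omega) ha' hb' hpos' h' hm'
  obtain ⟨c, d, rfl, hd, hc⟩ := exists_sq_mul_squarefree hb
  have hd0 : d ≠ 0 := hd.ne_zero
  have hsym : ∀ p : ℕ, p.Prime → p ≠ 2 → oddSymbol p a d = 0 := fun p hp hp2 => by
    rw [← oddSymbol_mul_sq hp hd0 hc, h p hp hp2]
  have hposd : 0 < a ∨ 0 < d := by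
    rcases hpos with h1 | h1
    · exact Or.inl h1
    · exact Or.inr ((mul_pos_iff_of_pos_left (by positivity)).mp h1)
  refine ConicSolvable.mul_sq ?_ hc
  rcases lt_or_ge (d.natAbs) ((c ^ 2 * d).natAbs) with hlt | hge
  · exact ih _ (by omega) ha hd0 hposd hsym rfl
  have hle : a.natAbs ≤ d.natAbs := hab.trans hge
  have hdle : d.natAbs ≤ (c ^ 2 * d).natAbs := by
    rw [Int.natAbs_mul]
    exact Nat.le_mul_of_pos_left _ (Int.natAbs_pos.mpr (pow_ne_zero 2 hc))
  rcases Nat.lt_or_ge d.natAbs 2 with hd1 | hd2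
  -- Both are `±1` here, and the sign condition excludes `a = d = -1`.
  · have h1 : a = 1 ∨ d = 1 := by omega
    rcases h1 with rfl | rfl
    · exact ⟨1, 0, 1, by simp, by ring⟩
    · exact ⟨0, 1, 1, by simp, by ring⟩
  obtain ⟨t, b', ht, htb⟩ := exists_sq_sub_eq_mul hd (isSquare_of_oddSymbol_eq_zero hd hsym)
  rcases eq_or_ne b' 0 with rfl | hb'
  · exact ⟨1, 0, t, by simp, by linarith⟩
  refine ConicSolvable.of_norm (b' := b') ?_ hb' hd0 ht
  -- `|d b'| ≤ t² + |a| ≤ d²/4 + |d|`, which is less than `d²` for `|d| ≥ 2`.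
  have hlt : b'.natAbs < d.natAbs := by
    have h1 : |d| * |b'| ≤ t ^ 2 + |a| := by
      rw [← abs_mul, ← ht]
      calc |t ^ 2 - a| ≤ |t ^ 2| + |a| := abs_sub _ _
        _ = t ^ 2 + |a| := by rw [abs_of_nonneg (sq_nonneg t)]
    have h2 : |a| ≤ |d| := by rw [Int.abs_eq_natAbs, Int.abs_eq_natAbs]; exact_mod_cast hle
    have h3 : 2 ≤ |d| := by rw [Int.abs_eq_natAbs]; exact_mod_cast hd2
    have h4 : |b'| < |d| := by
      by_contra! h5
      have h6 : d ^ 2 = |d| * |d| := by rw [← sq, sq_abs]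
      nlinarith
    rw [Int.abs_eq_natAbs, Int.abs_eq_natAbs] at h4
    exact_mod_cast h4
  refine ih _ (by omega) ha hb' ?_ ?_ rfl
  · rcases lt_or_gt_of_ne ha with ha' | ha'
    · right
      have hdpos : 0 < d := by
        rcases hposd with h1 | h1
        · exact absurd h1 ha'.not_gt
        · exact h1
      have : 0 < d * b' := by rw [← ht]; nlinarith [sq_nonneg t]
      exact (mul_pos_iff_of_pos_left hdpos).mp this
    · exact Or.inl ha'
  -- `a + d b' = t²` makes the symbol of `a` and `d b'` trivial, so the local conditions pass from
  -- `d` to `b'`.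
  · intro p hp hp2
    have h1 := oddSymbol_eq_zero_of_add_eq_sq hp ha (mul_ne_zero hd0 hb') (c := t) (by rw [← ht]; ring)
    rwa [oddSymbol_mul_right hp hd0 hb', hsym p hp hp2, zero_add] at h1

/-! ### The product formula. -/

/-- The sum of the local symbols at `2`, at infinity and at the odd primes of `T`. -/
def symbolSum (T : Finset ℕ) (a b : ℤ) : ZMod 2 :=
  ∑ p ∈ T, oddSymbol p a b + twoSymbol a b + realSymbol a b

theorem twoSymbol_mul_left {a a' : ℤ} (ha : a ≠ 0) (ha' : a' ≠ 0) (b : ℤ) :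
    twoSymbol (a * a') b = twoSymbol a b + twoSymbol a' b := by
  rw [twoSymbol, twoCls_mul ha ha', twoPair_add_left]; rfl

theorem realSymbol_mul_left {a a' : ℤ} (ha : a ≠ 0) (ha' : a' ≠ 0) (b : ℤ) :
    realSymbol (a * a') b = realSymbol a b + realSymbol a' b := by
  rw [realSymbol, signBit_mul ha ha', add_mul]; rfl

theorem symbolSum_comm (T : Finset ℕ) (a b : ℤ) : symbolSum T a b = symbolSum T b a := by
  unfold symbolSum
  rw [twoSymbol, twoPair_comm, realSymbol, mul_comm, Finset.sum_congr rfl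
    (fun p _ => oddSymbol_comm p a b)]
  rfl

theorem symbolSum_mul_left {T : Finset ℕ} (hT : ∀ p ∈ T, p.Prime) {a a' : ℤ} (ha : a ≠ 0)
    (ha' : a' ≠ 0) (b : ℤ) :
    symbolSum T (a * a') b = symbolSum T a b + symbolSum T a' b := by
  unfold symbolSum
  rw [twoSymbol_mul_left ha ha', realSymbol_mul_left ha ha',
    Finset.sum_congr rfl (fun p hp => oddSymbol_mul_left (hT p hp) ha ha' b),
    Finset.sum_add_distrib]
  ring

/-- The multiplicative monoid of nonzero integers is generated by `-1` and the primes;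
bimultiplicativity reduces the product formula to these. -/
theorem int_induction_on_primes {P : ℤ → Prop} (h1 : P (-1))
    (hp : ∀ p : ℕ, p.Prime → P p) (hmul : ∀ a b : ℤ, a ≠ 0 → b ≠ 0 → P a → P b → P (a * b))
    {a : ℤ} (ha : a ≠ 0) : P a := by
  have hone : P 1 := by
    have := hmul (-1) (-1) (by norm_num) (by norm_num) h1 h1
    simpa using this
  have hnat : ∀ n : ℕ, n ≠ 0 → P n := by
    intro n
    induction n using induction_on_primes with
    | zero => simp
    | one => intro _; exact_mod_cast hone
    | prime_mul p m hpp ih =>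
      intro h
      have hm : m ≠ 0 := right_ne_zero_of_mul h
      push_cast
      exact hmul _ _ (by exact_mod_cast hpp.ne_zero) (by exact_mod_cast hm) (hp p hpp) (ih hm)
  rcases Int.natAbs_eq a with h | h
  · rw [h]; exact hnat _ (Int.natAbs_ne_zero.mpr ha)
  · rw [h, neg_eq_neg_one_mul]
    exact hmul _ _ (by norm_num) (by exact_mod_cast Int.natAbs_ne_zero.mpr ha) h1
      (hnat _ (Int.natAbs_ne_zero.mpr ha))

theorem oddCls_self {p : ℕ} (hp : p.Prime) : oddCls p p = (1, 0) := by
  have := oddCls_pow_mul hp 1 (u := 1) (Nat.prime_iff_prime_int.mp hp).not_dvd_one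
  simpa [resBit_one] using this

theorem not_dvd_prime {p q : ℕ} (hp : p.Prime) (hq : q.Prime) (h : p ≠ q) : ¬ (p : ℤ) ∣ q := by
  rw [Int.natCast_dvd_natCast, Nat.prime_dvd_prime_iff_eq hp hq]; exact h

theorem not_dvd_neg_one {p : ℕ} (hp : p.Prime) : ¬ (p : ℤ) ∣ -1 := by
  rw [dvd_neg]; exact (Nat.prime_iff_prime_int.mp hp).not_dvd_one

theorem oddSymbol_prime_unit {q : ℕ} (hq : q.Prime) {u : ℤ} (hu : ¬ (q : ℤ) ∣ u) :
    oddSymbol q q u = resBit q u := by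
  rw [oddSymbol, oddCls_self hq, oddCls_unit hq hu]
  simp [oddPair]

theorem twoCls_two : twoCls 2 = (1, 0, 0) := by
  have := twoCls_pow_mul 1 (u := 1) (by norm_num)
  simpa [epsBit, omegaBit] using this

theorem twoCls_neg_one : twoCls (-1) = (0, 1, 0) := by
  rw [twoCls_unit (by norm_num)]; decide

theorem twoCls_odd_prime {q : ℕ} (hq : q.Prime) (hq2 : q ≠ 2) :
    twoCls q = (0, epsBit q, omegaBit q) :=
  twoCls_unit (by simpa using not_dvd_prime Nat.prime_two hq hq2.symm)

theorem odd_mod_cases {q : ℕ} (hq : q.Prime) (hq2 : q ≠ 2) :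
    q % 8 = 1 ∨ q % 8 = 3 ∨ q % 8 = 5 ∨ q % 8 = 7 := by
  have := hq.eq_two_or_odd
  omega

theorem resBit_neg_one {q : ℕ} (hq : q.Prime) (hq2 : q ≠ 2) : resBit q (-1) = epsBit q := by
  have h := odd_mod_cases hq hq2
  unfold resBit epsBit
  rw [jacobiSym.at_neg_one (hq.odd_of_ne_two hq2), ZMod.χ₄_nat_eq_if_mod_four]
  have h2 : q % 2 = 1 := by omega
  rcases (by omega : q % 4 = 1 ∨ q % 4 = 3) with h4 | h4
  · simp [h2, h4, (by omega : (q : ℤ) % 4 = 1)]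
  · simp [h2, h4, (by omega : (q : ℤ) % 4 = 3)]

theorem resBit_two {q : ℕ} (hq : q.Prime) (hq2 : q ≠ 2) : resBit q 2 = omegaBit q := by
  have h := odd_mod_cases hq hq2
  unfold resBit omegaBit
  rw [jacobiSym.at_two (hq.odd_of_ne_two hq2), ZMod.χ₈_nat_eq_if_mod_eight]
  have h2 : q % 2 = 1 := by omega
  rcases h with h8 | h8 | h8 | h8
  · simp [h2, h8, (by omega : (q : ℤ) % 8 = 1)]
  · simp [h2, h8, (by omega : (q : ℤ) % 8 = 3)]
  · simp [h2, h8, (by omega : (q : ℤ) % 8 = 5)]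
  · simp [h2, h8, (by omega : (q : ℤ) % 8 = 7)]

theorem resBit_reciprocity {q r : ℕ} (hq : q.Prime) (hq2 : q ≠ 2) (hr : r.Prime) (hr2 : r ≠ 2)
    (hqr : q ≠ r) : resBit q r + resBit r q = epsBit q * epsBit r := by
  have h1 := odd_mod_cases hq hq2
  have h2 := odd_mod_cases hr hr2
  have h3 := jacobiSym.quadratic_reciprocity (hq.odd_of_ne_two hq2) (hr.odd_of_ne_two hr2)
  unfold resBit epsBit
  -- Both sides depend only on the two Jacobi symbols and the residues modulo `4`; cases
  -- incompatible with reciprocity are discarded.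
  rcases jacobiSym_eq_one_or hr (not_dvd_prime hr hq hqr.symm) with h4 | h4 <;>
  rcases jacobiSym_eq_one_or hq (not_dvd_prime hq hr hqr) with h5 | h5 <;>
  rw [h4, h5] at h3 <;> rw [h4, h5] <;>
  rcases (by omega : q % 4 = 1 ∨ q % 4 = 3) with h6 | h6 <;>
  rcases (by omega : r % 4 = 1 ∨ r % 4 = 3) with h7 | h7 <;>
  (have h8 : (q : ℤ) % 4 = (q % 4 : ℕ) := by push_cast; rfl
   have h9 : (r : ℤ) % 4 = (r % 4 : ℕ) := by push_cast; rfl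
   rw [h8, h9, h6, h7]
   rw [neg_one_pow_eq_pow_mod_two, Nat.mul_mod] at h3
   first
   | rw [(by omega : q / 2 % 2 = 0), (by omega : r / 2 % 2 = 0)] at h3
   | rw [(by omega : q / 2 % 2 = 0), (by omega : r / 2 % 2 = 1)] at h3
   | rw [(by omega : q / 2 % 2 = 1), (by omega : r / 2 % 2 = 0)] at h3
   | rw [(by omega : q / 2 % 2 = 1), (by omega : r / 2 % 2 = 1)] at h3
   first
   | (exfalso; revert h3; decide)
   | decide)

theorem signBit_natCast (n : ℕ) : signBit n = 0 := by simp [signBit]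

theorem symbolSum_neg_one_neg_one {T : Finset ℕ} (hT : ∀ p ∈ T, p.Prime) :
    symbolSum T (-1) (-1) = 0 := by
  unfold symbolSum
  rw [Finset.sum_eq_zero (fun p hp => oddSymbol_unit (hT p hp) (not_dvd_neg_one (hT p hp))
    (not_dvd_neg_one (hT p hp))), twoSymbol, twoCls_neg_one]
  decide

theorem symbolSum_prime_neg_one {T : Finset ℕ} (hT : ∀ p ∈ T, p.Prime ∧ p ≠ 2) {q : ℕ}
    (hq : q.Prime) (hqT : q ≠ 2 → q ∈ T) : symbolSum T q (-1) = 0 := by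
  unfold symbolSum
  rw [twoSymbol, twoCls_neg_one, realSymbol, signBit_natCast, zero_mul, add_zero]
  rcases eq_or_ne q 2 with rfl | hq2
  · rw [Finset.sum_eq_zero (fun p hp => oddSymbol_unit (hT p hp).1
      (not_dvd_prime (hT p hp).1 hq (hT p hp).2) (not_dvd_neg_one (hT p hp).1)),
      Nat.cast_ofNat, twoCls_two]
    decide
  · rw [Finset.sum_eq_single_of_mem q (hqT hq2) (fun p hp hpq => oddSymbol_unit (hT p hp).1
      (not_dvd_prime (hT p hp).1 hq hpq) (not_dvd_neg_one (hT p hp).1)),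
      oddSymbol_prime_unit hq (not_dvd_neg_one hq), resBit_neg_one hq hq2,
      twoCls_odd_prime hq hq2]
    simp [twoPair, zmod_two_add_self]

theorem symbolSum_prime_two {T : Finset ℕ} (hT : ∀ p ∈ T, p.Prime ∧ p ≠ 2) {q : ℕ}
    (hq : q.Prime) (hqT : q ≠ 2 → q ∈ T) : symbolSum T q (2 : ℕ) = 0 := by
  unfold symbolSum
  rw [twoSymbol, realSymbol, signBit_natCast, zero_mul, add_zero]
  have h2 : ∀ p ∈ T, ¬ (p : ℤ) ∣ (2 : ℕ) := fun p hp =>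
    not_dvd_prime (hT p hp).1 Nat.prime_two (hT p hp).2
  rcases eq_or_ne q 2 with rfl | hq2
  · rw [Finset.sum_eq_zero (fun p hp => oddSymbol_unit (hT p hp).1 (h2 p hp) (h2 p hp)),
      Nat.cast_ofNat, twoCls_two]
    decide
  · rw [Finset.sum_eq_single_of_mem q (hqT hq2) (fun p hp hpq => oddSymbol_unit (hT p hp).1
      (not_dvd_prime (hT p hp).1 hq hpq) (h2 p hp)),
      oddSymbol_prime_unit hq (h2 q (hqT hq2)), Nat.cast_ofNat, resBit_two hq hq2,
      twoCls_odd_prime hq hq2, twoCls_two]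
    simp [twoPair, zmod_two_add_self]

theorem symbolSum_prime_prime {T : Finset ℕ} (hT : ∀ p ∈ T, p.Prime ∧ p ≠ 2) {q r : ℕ}
    (hq : q.Prime) (hqT : q ≠ 2 → q ∈ T) (hr : r.Prime) (hrT : r ≠ 2 → r ∈ T) :
    symbolSum T q r = 0 := by
  rcases eq_or_ne r 2 with rfl | hr2
  · exact symbolSum_prime_two hT hq hqT
  rcases eq_or_ne q 2 with rfl | hq2
  · rw [symbolSum_comm]; exact symbolSum_prime_two hT hr hrT
  have hqT := hqT hq2
  have hrT := hrT hr2
  unfold symbolSum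
  rw [twoSymbol, realSymbol, signBit_natCast, zero_mul, add_zero, twoCls_odd_prime hq hq2,
    twoCls_odd_prime hr hr2]
  rcases eq_or_ne q r with rfl | hqr
  · rw [Finset.sum_eq_single_of_mem q hqT (fun p hp hpq => oddSymbol_unit (hT p hp).1
      (not_dvd_prime (hT p hp).1 hq hpq) (not_dvd_prime (hT p hp).1 hq hpq)), oddSymbol,
      oddCls_self hq, resBit_neg_one hq hq2]
    -- The symbol of `q` with itself is the character of `-1` modulo `q`, and it cancels against the
    -- square of `epsBit q` at `2`.
    simp only [oddPair, twoPair]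
    generalize epsBit q = e
    generalize omegaBit q = w
    revert e w; decide
  · rw [← Finset.sum_subset (s₁ := {q, r}) (by
      intro x hx; rcases Finset.mem_insert.mp hx with rfl | hx
      · exact hqT
      · rwa [Finset.mem_singleton.mp hx]) (fun p hp hpn => by
        have h1 : p ≠ q := fun h => hpn (by simp [h])
        have h2 : p ≠ r := fun h => hpn (by simp [h])
        exact oddSymbol_unit (hT p hp).1 (not_dvd_prime (hT p hp).1 hq h1)
          (not_dvd_prime (hT p hp).1 hr h2)), Finset.sum_pair hqr,
      oddSymbol_prime_unit hq (not_dvd_prime hq hr hqr), oddSymbol_comm,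
      oddSymbol_prime_unit hr (not_dvd_prime hr hq hqr.symm),
      resBit_reciprocity hq hq2 hr hr2 hqr]
    simp [twoPair, zmod_two_add_self]

/-- The product formula for Hilbert symbols. -/
theorem symbolSum_eq_zero {T : Finset ℕ} (hT : ∀ p ∈ T, p.Prime ∧ p ≠ 2) {a b : ℤ} (ha : a ≠ 0)
    (hb : b ≠ 0) (haT : ∀ p : ℕ, p.Prime → p ≠ 2 → (p : ℤ) ∣ a → p ∈ T)
    (hbT : ∀ p : ℕ, p.Prime → p ≠ 2 → (p : ℤ) ∣ b → p ∈ T) : symbolSum T a b = 0 := by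
  have hT' : ∀ p ∈ T, p.Prime := fun p hp => (hT p hp).1
  have key : ∀ b : ℤ, b ≠ 0 → (∀ a : ℤ, a ≠ 0 →
      (∀ p : ℕ, p.Prime → p ≠ 2 → (p : ℤ) ∣ a → p ∈ T) →
      symbolSum T (-1) b = 0 →
      (∀ q : ℕ, q.Prime → (q ≠ 2 → q ∈ T) → symbolSum T q b = 0) → symbolSum T a b = 0) := by
    intro b _ a ha haT h1 h2
    revert haT
    refine int_induction_on_primes (P := fun a => (∀ p : ℕ, p.Prime → p ≠ 2 → (p : ℤ) ∣ a → p ∈ T)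
      → symbolSum T a b = 0) (fun _ => h1) (fun q hq hqT => h2 q hq fun h => hqT q hq h dvd_rfl)
      ?_ ha
    intro x y hx hy ihx ihy hxy
    rw [symbolSum_mul_left hT' hx hy,
      ihx fun p hp hp2 h => hxy p hp hp2 (h.mul_right y),
      ihy fun p hp hp2 h => hxy p hp hp2 (h.mul_left x), add_zero]
  refine key b hb a ha haT ?_ fun q hq hqT => ?_
  · rw [symbolSum_comm]
    exact key (-1) (by norm_num) b hb hbT (symbolSum_neg_one_neg_one hT')
      fun q hq hqT => symbolSum_prime_neg_one hT hq hqT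
  · rw [symbolSum_comm]
    refine key q (by exact_mod_cast hq.ne_zero) b hb hbT ?_
      fun r hr hrT => symbolSum_prime_prime hT hr hrT hq hqT
    rw [symbolSum_comm]
    exact symbolSum_prime_neg_one hT hq hqT

/-- A Hilbert symbol that is trivial at all places but one is trivial there too. -/
theorem oddSymbol_eq_zero_of_forall_ne {a b : ℤ} (ha : a ≠ 0) (hb : b ≠ 0)
    (h2 : twoSymbol a b = 0) (hr : realSymbol a b = 0) {l : ℕ}
    (h : ∀ p : ℕ, p.Prime → p ≠ 2 → p ≠ l → oddSymbol p a b = 0) (p : ℕ) (hp : p.Prime)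
    (hp2 : p ≠ 2) : oddSymbol p a b = 0 := by
  rcases ne_or_eq p l with hpl | rfl
  · exact h p hp hp2 hpl
  set T := (insert p ((a * b).natAbs.primeFactors)).erase 2 with hTdef
  have hab : (a * b).natAbs ≠ 0 := Int.natAbs_ne_zero.mpr (mul_ne_zero ha hb)
  have hT : ∀ q ∈ T, q.Prime ∧ q ≠ 2 := by
    intro q hq
    obtain ⟨h1, h2⟩ := Finset.mem_erase.mp hq
    rcases Finset.mem_insert.mp h2 with rfl | h2
    · exact ⟨hp, h1⟩
    · exact ⟨Nat.prime_of_mem_primeFactors h2, h1⟩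
  have hmem : ∀ q : ℕ, q.Prime → q ≠ 2 → (q : ℤ) ∣ a * b → q ∈ T := by
    intro q hq hq2 hd
    exact Finset.mem_erase.mpr ⟨hq2, Finset.mem_insert_of_mem
      (Nat.mem_primeFactors.mpr ⟨hq, Int.natCast_dvd.mp hd, hab⟩)⟩
  have h3 := symbolSum_eq_zero hT ha hb (fun q hq hq2 hd => hmem q hq hq2 (hd.mul_right b))
    (fun q hq hq2 hd => hmem q hq hq2 (hd.mul_left a))
  have hpT : p ∈ T := Finset.mem_erase.mpr ⟨hp2, Finset.mem_insert_self _ _⟩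
  rw [symbolSum, h2, hr, Finset.sum_eq_single_of_mem p hpT
    (fun q hq hqp => h q (hT q hq).1 (hT q hq).2 hqp)] at h3
  simpa using h3

/-! Local choices at each place. -/

section Local

/-- After translation by `x`, the admissible `t` form the kernel of a character of the square class
group. The kernel has index at most two, hence more than one element, and `u` can be avoided. -/
theorem exists_first_two (x y u : ZMod 2 × ZMod 2 × ZMod 2) :
    ∃ t, twoPair (x + t) (y + t) = 0 ∧ t ≠ u := by
  revert x y u; decide

theorem exists_first_odd (e : ZMod 2) (x y u : ZMod 2 × ZMod 2) :
    ∃ t, oddPair e (x + t) (y + t) = 0 ∧ t ≠ u := by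
  revert e x y u; decide

/-- A ternary form represents every square class except possibly minus its determinant. With `d = x
+ y`, the two conditions on `s` are affine equations for the characters of `-d` and of `g = (0, e) +
z + t`; the first is homogeneous. By nondegeneracy they are jointly solvable when `g` is not the
class of `-d`, which is the hypothesis on `t`. -/
theorem exists_second_odd (e : ZMod 2) (x y z t : ZMod 2 × ZMod 2) (h : t ≠ x + y + z) :
    ∃ s, oddPair e (x + s) (y + s) = 0 ∧ oddPair e ((0, e) + z + t) ((0, e) + z + s) = 0 := by
  have key : ∀ (e : ZMod 2) (d g h : ZMod 2 × ZMod 2), g ≠ (0, e) + d →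
      ∃ s, oddPair e s (s + d) = 0 ∧ oddPair e g (h + s) = 0 := by decide
  have h2 : ∀ v : ZMod 2 × ZMod 2, v + v = 0 := CharTwo.add_self_eq_zero
  obtain ⟨s, h3, h4⟩ := key e (x + y) ((0, e) + z + t) ((0, e) + z + x) fun h' =>
    h (by linear_combination h' - h2 z)
  refine ⟨x + s, ?_, ?_⟩
  · rw [show x + (x + s) = s by linear_combination h2 x,
      show y + (x + s) = s + (x + y) by ring]
    exact h3
  · rw [show (0, e) + z + (x + s) = (0, e) + z + x + s by ring]
    exact h4

theorem exists_second_two (x y z t : ZMod 2 × ZMod 2 × ZMod 2) (h : t ≠ x + y + z) :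
    ∃ s, twoPair (x + s) (y + s) = 0 ∧ twoPair ((0, 1, 0) + z + t) ((0, 1, 0) + z + s) = 0 := by
  have key : ∀ (d g h : ZMod 2 × ZMod 2 × ZMod 2), g ≠ (0, 1, 0) + d →
      ∃ s, twoPair s (s + d) = 0 ∧ twoPair g (h + s) = 0 := by decide
  have h2 : ∀ v : ZMod 2 × ZMod 2 × ZMod 2, v + v = 0 := CharTwo.add_self_eq_zero
  obtain ⟨s, h3, h4⟩ := key (x + y) ((0, 1, 0) + z + t) ((0, 1, 0) + z + x) fun h' =>
    h (by linear_combination h' - h2 z)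
  refine ⟨x + s, ?_, ?_⟩
  · rw [show x + (x + s) = s by linear_combination h2 x,
      show y + (x + s) = s + (x + y) by ring]
    exact h3
  · rw [show (0, 1, 0) + z + (x + s) = (0, 1, 0) + z + x + s by ring]
    exact h4

theorem exists_odd (e : ZMod 2) (x₁ x₂ x₃ x₄ x₅ : ZMod 2 × ZMod 2) :
    ∃ t s, oddPair e (x₁ + t) (x₂ + t) = 0 ∧ oddPair e (x₃ + s) (x₄ + s) = 0 ∧
      oddPair e ((0, e) + x₅ + t) ((0, e) + x₅ + s) = 0 := by
  obtain ⟨t, h1, h2⟩ := exists_first_odd e x₁ x₂ (x₃ + x₄ + x₅)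
  obtain ⟨s, h3, h4⟩ := exists_second_odd e x₃ x₄ x₅ t h2
  exact ⟨t, s, h1, h3, h4⟩

theorem exists_two (x₁ x₂ x₃ x₄ x₅ : ZMod 2 × ZMod 2 × ZMod 2) :
    ∃ t s, twoPair (x₁ + t) (x₂ + t) = 0 ∧ twoPair (x₃ + s) (x₄ + s) = 0 ∧
      twoPair ((0, 1, 0) + x₅ + t) ((0, 1, 0) + x₅ + s) = 0 := by
  obtain ⟨t, h1, h2⟩ := exists_first_two x₁ x₂ (x₃ + x₄ + x₅)
  obtain ⟨s, h3, h4⟩ := exists_second_two x₃ x₄ x₅ t h2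
  exact ⟨t, s, h1, h3, h4⟩

/-- The real square class group is too small to avoid a class as at the finite places; here
indefiniteness is what makes the choice possible. -/
theorem exists_real (x : Fin 5 → ZMod 2) (h0 : ∃ i, x i = 0) (h1 : ∃ i, x i = 1) :
    ∃ t s, (x 0 + t) * (x 1 + t) = 0 ∧ (x 2 + s) * (x 3 + s) = 0 ∧
      (1 + x 4 + t) * (1 + x 4 + s) = 0 := by
  have key : ∀ a b c d e : ZMod 2, (∃ i, ![a, b, c, d, e] i = 0) → (∃ i, ![a, b, c, d, e] i = 1) →
      ∃ t s, (a + t) * (b + t) = 0 ∧ (c + s) * (d + s) = 0 ∧ (1 + e + t) * (1 + e + s) = 0 := by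
    decide
  have hx : x = ![x 0, x 1, x 2, x 3, x 4] := by
    ext i; fin_cases i <;> rfl
  rw [hx] at h0 h1
  exact key _ _ _ _ _ h0 h1

end Local

/-! ### Integers with prescribed square classes, by Dirichlet's theorem. -/

theorem exists_resBit_eq {p : ℕ} (hp : p.Prime) (hp2 : p ≠ 2) (d : ZMod 2) :
    ∃ r : ℕ, ¬ (p : ℤ) ∣ r ∧ resBit p r = d := by
  have := Fact.mk hp
  rcases (by revert d; decide : d = 0 ∨ d = 1) with rfl | rfl
  · exact ⟨1, by exact_mod_cast (Nat.prime_iff_prime_int.mp hp).not_dvd_one, by simpa using resBit_one p⟩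
  · obtain ⟨a, ha⟩ := FiniteField.exists_nonsquare (F := ZMod p) (by rwa [ZMod.ringChar_zmod_n])
    have hv : ((a.val : ℤ) : ZMod p) = a := by simp
    have h0 : ¬ (p : ℤ) ∣ a.val := by
      rw [← ZMod.intCast_zmod_eq_zero_iff_dvd, hv]
      rintro rfl
      exact ha IsSquare.zero
    refine ⟨a.val, h0, ?_⟩
    have h1 := (resBit_eq_zero_iff hp h0).not.mpr (by rwa [hv])
    generalize resBit p (a.val : ℤ) = b at h1
    revert b; decide

theorem exists_prime_resBit {S : Finset ℕ} (hS : ∀ p ∈ S, p.Prime ∧ p ≠ 2) (d : ℕ → ZMod 2)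
    (ε ω : ZMod 2) :
    ∃ l : ℕ, l.Prime ∧ l ≠ 2 ∧ l ∉ S ∧ (∀ p ∈ S, resBit p l = d p) ∧ epsBit l = ε ∧
      omegaBit l = ω := by
  have h8 : ∃ r : ℕ, ¬ 2 ∣ r ∧ epsBit r = ε ∧ omegaBit r = ω := by
    have : ∀ ε ω : ZMod 2, ∃ r : Fin 8, ¬ 2 ∣ (r : ℕ) ∧ epsBit (r : ℕ) = ε ∧
      omegaBit (r : ℕ) = ω := by decide
    obtain ⟨r, hr⟩ := this ε ω
    exact ⟨r, hr⟩
  obtain ⟨r₂, hr₂, hε, hω⟩ := h8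
  have hex : ∀ p : ℕ, ∃ r : ℕ, p ∈ S → ¬ (p : ℤ) ∣ r ∧ resBit p r = d p := by
    intro p
    by_cases hp : p ∈ S
    · obtain ⟨r, hr⟩ := exists_resBit_eq (hS p hp).1 (hS p hp).2 (d p)
      exact ⟨r, fun _ => hr⟩
    · exact ⟨0, fun h => absurd h hp⟩
  choose r hr using hex
  have h2S : 2 ∉ S := fun h => (hS 2 h).2 rfl
  -- The index `2` carries the modulus `8`, so that both characters at `2` are controlled.
  obtain ⟨k, hk⟩ := Nat.chineseRemainderOfFinset (fun p => if p = 2 then r₂ else r p)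
    (fun p => if p = 2 then 8 else p) (insert 2 S)
    (by
      intro p hp
      split_ifs with h
      · norm_num
      · exact (hS p ((Finset.mem_insert.mp hp).resolve_left h)).1.ne_zero)
    (by
      intro p hp q hq hpq
      have hp' : p = 2 ∨ p ∈ S := Finset.mem_insert.mp (Finset.mem_coe.mp hp)
      have hq' : q = 2 ∨ q ∈ S := Finset.mem_insert.mp (Finset.mem_coe.mp hq)
      have hpp : p.Prime := by
        rcases hp' with rfl | h
        · exact Nat.prime_two
        · exact (hS p h).1
      have hqp : q.Prime := by
        rcases hq' with rfl | h
        · exact Nat.prime_two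
        · exact (hS q h).1
      have hc : p.Coprime q := (Nat.coprime_primes hpp hqp).mpr hpq
      simp only [Function.onFun]
      split_ifs with h1 h2 h2
      · exact absurd (h1.trans h2.symm) hpq
      · subst h1; exact Nat.Coprime.pow_left 3 hc
      · subst h2; exact Nat.Coprime.pow_right 3 hc
      · exact hc)
  have hk2 : k ≡ r₂ [MOD 8] := by simpa using hk 2 (Finset.mem_insert_self _ _)
  have hkS : ∀ p ∈ S, k ≡ r p [MOD p] := by
    intro p hp
    have := hk p (Finset.mem_insert_of_mem hp)
    simpa [(hS p hp).2] using this
  set M := 8 * ∏ p ∈ S, p with hM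
  have hM0 : M ≠ 0 := by
    simp only [hM, ne_eq, mul_eq_zero, OfNat.ofNat_ne_zero, false_or, Finset.prod_eq_zero_iff]
    rintro ⟨p, hp, rfl⟩
    exact (hS 0 hp).1.ne_zero rfl
  have : NeZero M := ⟨hM0⟩
  have hcop : k.Coprime M := by
    refine Nat.Coprime.mul_right ?_ (Nat.Coprime.prod_right fun p hp => ?_)
    · have h2 : Nat.Coprime k 2 := by
        rw [Nat.coprime_comm, Nat.prime_two.coprime_iff_not_dvd]
        have := hk2
        unfold Nat.ModEq at this
        omega
      exact Nat.Coprime.pow_right 3 h2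
    · rw [Nat.coprime_comm, (hS p hp).1.coprime_iff_not_dvd]
      intro h
      exact (hr p hp).1 (Int.natCast_dvd_natCast.mpr (((hkS p hp).dvd_iff dvd_rfl).mp h))
  -- Dirichlet's theorem, with a prime larger than `M` so that it lies outside `S`.
  obtain ⟨l, hl, hlp, hlk⟩ := Nat.forall_exists_prime_gt_and_eq_mod
    ((ZMod.isUnit_iff_coprime k M).mpr hcop) M
  have hlk' : l ≡ k [MOD M] := (ZMod.natCast_eq_natCast_iff _ _ _).mp hlk
  have hl2 : l ≡ r₂ [MOD 8] := (hlk'.of_dvd (Dvd.intro _ rfl)).trans hk2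
  have hl8 : (l : ℤ) % 8 = (r₂ : ℤ) % 8 := by
    unfold Nat.ModEq at hl2; omega
  have hdvd : ∀ p ∈ S, p ∣ M := fun p hp => (Finset.dvd_prod_of_mem _ hp).mul_left 8
  refine ⟨l, hlp, ?_, ?_, ?_, ?_, ?_⟩
  · rintro rfl
    unfold Nat.ModEq at hl2; omega
  · intro h
    exact absurd (Nat.le_of_dvd (Nat.pos_of_ne_zero hM0) (hdvd l h)) (not_le.mpr hl)
  · intro p hp
    rw [← (hr p hp).2]
    exact resBit_congr ((Int.natCast_modEq_iff).mpr ((hlk'.of_dvd (hdvd p hp)).trans (hkS p hp)))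
  · rw [← hε]
    unfold epsBit
    rw [(by omega : (l : ℤ) % 4 = (r₂ : ℤ) % 4)]
  · rw [← hω]
    unfold omegaBit
    rw [hl8]

/-- An integer with prescribed sign and square classes at `2` and at the primes of `S`, which is
a unit at all other primes but one, where its valuation is odd. -/
theorem exists_int_cls {S : Finset ℕ} (hS : ∀ p ∈ S, p.Prime ∧ p ≠ 2)
    (c : ℕ → ZMod 2 × ZMod 2) (c₂ : ZMod 2 × ZMod 2 × ZMod 2) (σ : ZMod 2) :
    ∃ (t : ℤ) (l : ℕ), t ≠ 0 ∧ l.Prime ∧ l ≠ 2 ∧ l ∉ S ∧ (∀ p ∈ S, oddCls p t = c p) ∧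
      twoCls t = c₂ ∧ signBit t = σ ∧
      ∀ p : ℕ, p.Prime → p ≠ 2 → p ∉ S → p ≠ l → ¬ (p : ℤ) ∣ t := by
  have hval : ∀ R : Finset ℕ, R ⊆ S → ∃ t₀ : ℤ, 0 < t₀ ∧ (∀ p ∈ R, (oddCls p t₀).1 = (c p).1) ∧
      (∀ p : ℕ, p.Prime → p ∉ R → ¬ (p : ℤ) ∣ t₀) := by
    intro R
    induction R using Finset.induction_on with
    | empty => exact fun _ => ⟨1, one_pos, by simp, fun p hp _ =>
        (Nat.prime_iff_prime_int.mp hp).not_dvd_one⟩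
    | insert q R hqR ih =>
      intro hRS
      obtain ⟨t₀, h1, h2, h3⟩ := ih ((Finset.subset_insert q R).trans hRS)
      have hq := (hS q (hRS (Finset.mem_insert_self q R))).1
      have hqt := h3 q hq hqR
      refine ⟨(q : ℤ) ^ (c q).1.val * t₀, mul_pos (pow_pos (by exact_mod_cast hq.pos) _) h1,
        ?_, ?_⟩
      · intro p hp
        rcases Finset.mem_insert.mp hp with rfl | hp'
        · rw [oddCls_pow_mul hq _ hqt]
          simp
        · have hpp := (hS p (hRS hp)).1
          have hpq : p ≠ q := fun h => hqR (h ▸ hp')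
          rw [oddCls_mul hpp (pow_ne_zero _ (by exact_mod_cast hq.ne_zero)) h1.ne',
            oddCls_unit hpp (fun h => not_dvd_prime hpp hq hpq
              ((Nat.prime_iff_prime_int.mp hpp).dvd_of_dvd_pow h)), Prod.fst_add, h2 p hp', zero_add]
      · intro p hp hpR
        rw [Finset.mem_insert, not_or] at hpR
        exact not_dvd_mul hp (fun h => not_dvd_prime hp hq hpR.1
              ((Nat.prime_iff_prime_int.mp hp).dvd_of_dvd_pow h)) (h3 p hp hpR.2)
  obtain ⟨t₀, h1, h2, h3⟩ := hval S subset_rfl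
  have h2S : 2 ∉ S := fun h => (hS 2 h).2 rfl
  have ht2 : ¬ (2 : ℤ) ∣ t₀ := h3 2 Nat.prime_two h2S
  obtain ⟨sg, hsg, hsgσ⟩ : ∃ sg : ℤ, (sg = 1 ∨ sg = -1) ∧ signBit sg = σ := by
    rcases (by revert σ; decide : σ = 0 ∨ σ = 1) with rfl | rfl
    · exact ⟨1, Or.inl rfl, by decide⟩
    · exact ⟨-1, Or.inr rfl, by decide⟩
  have hsgd : ∀ p : ℕ, p.Prime → ¬ (p : ℤ) ∣ sg := fun p hp => by
    rcases hsg with rfl | rfl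
    · exact (Nat.prime_iff_prime_int.mp hp).not_dvd_one
    · exact not_dvd_neg_one hp
  have hsg0 : sg ≠ 0 := by rcases hsg with rfl | rfl <;> norm_num
  set t₁ : ℤ := 2 ^ c₂.1.val * (sg * t₀) with ht₁
  have ht₁0 : t₁ ≠ 0 := mul_ne_zero (by positivity) (mul_ne_zero hsg0 h1.ne')
  have ht₁c : twoCls t₁ = (c₂.1, epsBit (sg * t₀), omegaBit (sg * t₀)) := by
    rw [ht₁, twoCls_pow_mul _ (not_dvd_mul Nat.prime_two (hsgd 2 Nat.prime_two) ht2)]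
    simp
  have ht₁S : ∀ p ∈ S, (oddCls p t₁).1 = (c p).1 := by
    intro p hp
    have hpp := (hS p hp).1
    have h2p : ¬ (p : ℤ) ∣ 2 ^ c₂.1.val := fun h => not_dvd_prime hpp Nat.prime_two (hS p hp).2
      ((Nat.prime_iff_prime_int.mp hpp).dvd_of_dvd_pow h)
    rw [ht₁, oddCls_mul hpp (by positivity) (mul_ne_zero hsg0 h1.ne'), oddCls_mul hpp hsg0 h1.ne',
      oddCls_unit hpp h2p, oddCls_unit hpp (hsgd p hpp)]
    simp [h2 p hp]
  -- `t₁` already has the right valuations and sign; multiplying by the prime `l` corrects the unit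
  -- characters at `2` and on `S`.
  obtain ⟨l, hl, hl2, hlS, hl3, hl4, hl5⟩ := exists_prime_resBit hS
    (fun p => (c p).2 - (oddCls p t₁).2) (c₂.2.1 - (twoCls t₁).2.1) (c₂.2.2 - (twoCls t₁).2.2)
  have hl0 : (l : ℤ) ≠ 0 := by exact_mod_cast hl.ne_zero
  refine ⟨t₁ * l, l, mul_ne_zero ht₁0 hl0, hl, hl2, hlS, ?_, ?_, ?_, ?_⟩
  · intro p hp
    have hpp := (hS p hp).1
    have hpl : p ≠ l := fun h => hlS (h ▸ hp)
    rw [oddCls_mul hpp ht₁0 hl0, oddCls_unit hpp (not_dvd_prime hpp hl hpl), hl3 p hp]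
    ext
    · simp [ht₁S p hp]
    · simp
  · rw [twoCls_mul ht₁0 hl0, twoCls_odd_prime hl hl2, hl4, hl5]
    ext
    · simp [ht₁c]
    · simp
    · simp
  · rw [signBit_mul ht₁0 hl0, signBit_natCast, add_zero, ht₁, signBit_mul (by positivity)
      (mul_ne_zero hsg0 h1.ne'), signBit_mul hsg0 h1.ne', hsgσ]
    have e1 : signBit (2 ^ c₂.1.val) = 0 := by
      unfold signBit; rw [if_neg (by positivity : (0 : ℤ) < 2 ^ c₂.1.val).not_gt]
    have e2 : signBit t₀ = 0 := by unfold signBit; rw [if_neg h1.not_gt]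
    rw [e1, e2, zero_add, add_zero]
  · intro p hp hp2 hpS hpl
    exact not_dvd_mul hp (not_dvd_mul hp (fun h => not_dvd_prime hp Nat.prime_two hp2
      ((Nat.prime_iff_prime_int.mp hp).dvd_of_dvd_pow h)) (not_dvd_mul hp (hsgd p hp)
      (h3 p hp hpS))) (not_dvd_prime hp hl hpl)

/-! ### Meyer's theorem from three conics. -/

theorem ConicSolvable.exists_diag {A B t : ℤ} (ht : t ≠ 0) (h : ConicSolvable (A * t) (B * t)) :
    ∃ x y z : ℤ, (x ≠ 0 ∨ y ≠ 0 ∨ z ≠ 0) ∧ A * x ^ 2 + B * y ^ 2 = t * z ^ 2 := by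
  obtain ⟨x, y, z, h0, h⟩ := h
  refine ⟨t * x, t * y, z, ?_, by linear_combination -t * h⟩
  simpa [ht] using h0

theorem oddSymbol_mul_mul {p : ℕ} (hp : p.Prime) {A B t : ℤ} (hA : A ≠ 0) (hB : B ≠ 0)
    (ht : t ≠ 0) : oddSymbol p (A * t) (B * t) =
      oddPair (resBit p (-1)) (oddCls p A + oddCls p t) (oddCls p B + oddCls p t) := by
  rw [oddSymbol, oddCls_mul hp hA ht, oddCls_mul hp hB ht]

theorem twoSymbol_mul_mul {A B t : ℤ} (hA : A ≠ 0) (hB : B ≠ 0) (ht : t ≠ 0) :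
    twoSymbol (A * t) (B * t) = twoPair (twoCls A + twoCls t) (twoCls B + twoCls t) := by
  rw [twoSymbol, twoCls_mul hA ht, twoCls_mul hB ht]

theorem realSymbol_mul_mul {A B t : ℤ} (hA : A ≠ 0) (hB : B ≠ 0) (ht : t ≠ 0) :
    realSymbol (A * t) (B * t) = (signBit A + signBit t) * (signBit B + signBit t) := by
  rw [realSymbol, signBit_mul hA ht, signBit_mul hB ht]

/-- The product formula lets one odd prime `l` go unchecked, and the trivial real symbol supplies
the sign condition of Legendre's theorem. -/
theorem conicSolvable_of_symbols {a b : ℤ} (ha : a ≠ 0) (hb : b ≠ 0)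
    (h2 : twoSymbol a b = 0) (hr : realSymbol a b = 0) {l : ℕ}
    (h : ∀ p : ℕ, p.Prime → p ≠ 2 → p ≠ l → oddSymbol p a b = 0) : ConicSolvable a b := by
  refine conicSolvable_of_oddSymbol ha hb ?_ (oddSymbol_eq_zero_of_forall_ne ha hb h2 hr h)
  by_contra! hcon
  have h1 : a < 0 := lt_of_le_of_ne hcon.1 ha
  have h3 : b < 0 := lt_of_le_of_ne hcon.2 hb
  simp [realSymbol, signBit, h1, h3] at hr

/-- **Meyer's theorem** for diagonal forms in five variables. -/
theorem meyer_five (c : Fin 5 → ℤ) (hc : ∀ i, c i ≠ 0) (hpos : ∃ i, 0 < c i)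
    (hneg : ∃ i, c i < 0) : ∃ x : Fin 5 → ℤ, x ≠ 0 ∧ ∑ i, c i * x i ^ 2 = 0 := by
  have hprod : (∏ i, c i) ≠ 0 := Finset.prod_ne_zero_iff.mpr fun i _ => hc i
  set S : Finset ℕ := (∏ i, c i).natAbs.primeFactors.erase 2 with hSdef
  have hS : ∀ p ∈ S, p.Prime ∧ p ≠ 2 := fun p hp =>
    ⟨Nat.prime_of_mem_primeFactors (Finset.mem_of_mem_erase hp), Finset.ne_of_mem_erase hp⟩
  have hunit : ∀ p : ℕ, p.Prime → p ≠ 2 → p ∉ S → ∀ i, ¬ (p : ℤ) ∣ c i := by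
    intro p hp hp2 hpS i hd
    exact hpS (Finset.mem_erase.mpr ⟨hp2, Nat.mem_primeFactors.mpr
      ⟨hp, Int.natCast_dvd.mp (hd.trans (Finset.dvd_prod_of_mem c (Finset.mem_univ i))),
        Int.natAbs_ne_zero.mpr hprod⟩⟩)
  choose tc sc h12 h34 h5 using fun p : ℕ => exists_odd (resBit p (-1)) (oddCls p (c 0))
    (oddCls p (c 1)) (oddCls p (c 2)) (oddCls p (c 3)) (oddCls p (c 4))
  obtain ⟨t₂, s₂, d12, d34, d5⟩ := exists_two (twoCls (c 0)) (twoCls (c 1)) (twoCls (c 2))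
    (twoCls (c 3)) (twoCls (c 4))
  obtain ⟨tr, sr, r12, r34, r5⟩ := exists_real (fun i => signBit (c i))
    (by obtain ⟨i, hi⟩ := hpos; exact ⟨i, if_neg hi.not_gt⟩)
    (by obtain ⟨i, hi⟩ := hneg; exact ⟨i, if_pos hi⟩)
  obtain ⟨t, l, ht, hl, hl2, hlS, htS, ht2, htr, htu⟩ := exists_int_cls hS tc t₂ tr
  have hS' : ∀ p ∈ insert l S, p.Prime ∧ p ≠ 2 := by
    intro p hp
    rcases Finset.mem_insert.mp hp with rfl | hp
    · exact ⟨hl, hl2⟩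
    · exact hS p hp
  -- The uncontrolled prime `l` of `t` joins the places where `s` is prescribed. There `s` gets the
  -- class of the unit `-c 4`: this makes `s * (-c 4)` a local square, so the third conic is fine at
  -- `l`, and keeps the second one unramified there.
  obtain ⟨s, r, hs, -, -, -, hsS, hs2, hsr, hsu⟩ := exists_int_cls hS'
    (fun p => if p = l then (0, resBit l (-1 * c 4)) else sc p) s₂ sr
  have hsl : oddCls l s = (0, resBit l (-1 * c 4)) := by
    rw [hsS l (Finset.mem_insert_self _ _), if_pos rfl]
  have hsS : ∀ p ∈ S, oddCls p s = sc p := fun p hp => by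
    rw [hsS p (Finset.mem_insert_of_mem hp), if_neg (ne_of_mem_of_not_mem hp hlS)]
  have hm0 : (-1 : ℤ) * c 4 ≠ 0 := mul_ne_zero (by norm_num) (hc 4)
  have hmodd : ∀ p : ℕ, p.Prime → oddCls p (-1 * c 4) = (0, resBit p (-1)) + oddCls p (c 4) :=
    fun p hp => by rw [oddCls_mul hp (by norm_num) (hc 4), oddCls_unit hp (not_dvd_neg_one hp)]
  have conic1 : ConicSolvable (c 0 * t) (c 1 * t) := by
    refine conicSolvable_of_symbols (l := l) (mul_ne_zero (hc 0) ht) (mul_ne_zero (hc 1) ht)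
      ?_ ?_ fun p hp hp2 hpl => ?_
    · rw [twoSymbol_mul_mul (hc 0) (hc 1) ht, ht2, d12]
    · rw [realSymbol_mul_mul (hc 0) (hc 1) ht, htr, r12]
    · by_cases hpS : p ∈ S
      · rw [oddSymbol_mul_mul hp (hc 0) (hc 1) ht, htS p hpS, h12]
      · have hu := hunit p hp hp2 hpS
        have htp := htu p hp hp2 hpS hpl
        exact oddSymbol_unit hp (not_dvd_mul hp (hu 0) htp) (not_dvd_mul hp (hu 1) htp)
  have conic2 : ConicSolvable (c 2 * s) (c 3 * s) := by
    refine conicSolvable_of_symbols (l := r) (mul_ne_zero (hc 2) hs) (mul_ne_zero (hc 3) hs)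
      ?_ ?_ fun p hp hp2 hpr => ?_
    · rw [twoSymbol_mul_mul (hc 2) (hc 3) hs, hs2, d34]
    · rw [realSymbol_mul_mul (hc 2) (hc 3) hs, hsr, r34]
    · by_cases hpS : p ∈ S
      · rw [oddSymbol_mul_mul hp (hc 2) (hc 3) hs, hsS p hpS, h34]
      · have hu := hunit p hp hp2 hpS
        rcases eq_or_ne p l with rfl | hpl
        · rw [oddSymbol_mul_mul hp (hc 2) (hc 3) hs, hsl, oddCls_unit hp (hu 2),
            oddCls_unit hp (hu 3)]
          simp [oddPair]
        · have hsp := hsu p hp hp2 (by simp [hpl, hpS]) hpr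
          exact oddSymbol_unit hp (not_dvd_mul hp (hu 2) hsp) (not_dvd_mul hp (hu 3) hsp)
  have conic3 : ConicSolvable (t * (-1 * c 4)) (s * (-1 * c 4)) := by
    refine conicSolvable_of_symbols (l := r) (mul_ne_zero ht hm0) (mul_ne_zero hs hm0)
      ?_ ?_ fun p hp hp2 hpr => ?_
    · rw [twoSymbol_mul_mul ht hs hm0, twoCls_mul (by norm_num) (hc 4), twoCls_neg_one, ht2, hs2,
        add_comm t₂, add_comm s₂, d5]
    · rw [realSymbol_mul_mul ht hs hm0, signBit_mul (by norm_num) (hc 4), htr, hsr, add_comm tr,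
        add_comm sr, show signBit (-1) = 1 from rfl, r5]
    · by_cases hpS : p ∈ S
      · rw [oddSymbol_mul_mul hp ht hs hm0, htS p hpS, hsS p hpS, hmodd p hp, add_comm (tc p),
          add_comm (sc p), h5]
      · have hu := hunit p hp hp2 hpS
        have hmu := not_dvd_mul hp (not_dvd_neg_one hp) (hu 4)
        rcases eq_or_ne p l with rfl | hpl
        · rw [oddSymbol_mul_mul hp ht hs hm0, hsl, oddCls_unit hp hmu]
          simp [oddPair, zmod_two_add_self]
        · have hsp := hsu p hp hp2 (by simp [hpl, hpS]) hpr
          have htp := htu p hp hp2 hpS hpl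
          exact oddSymbol_unit hp (not_dvd_mul hp htp hmu) (not_dvd_mul hp hsp hmu)
  obtain ⟨x₀, x₁, z₁, hne1, e1⟩ := conic1.exists_diag ht
  obtain ⟨x₂, x₃, z₂, hne2, e2⟩ := conic2.exists_diag hs
  obtain ⟨u, v, w, hne3, e3⟩ := conic3.exists_diag hm0
  -- If `z₁` or `z₂` vanishes, the corresponding binary form is already isotropic; otherwise the
  -- three solutions are glued after clearing `z₁` and `z₂`.
  rcases eq_or_ne z₁ 0 with rfl | hz1
  · refine ⟨![x₀, x₁, 0, 0, 0], fun h => ?_, ?_⟩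
    · have e0 := congrFun h 0
      have e1 := congrFun h 1
      simp at e0 e1
      simp [e0, e1] at hne1
    · simp [Fin.sum_univ_five]
      linear_combination e1
  rcases eq_or_ne z₂ 0 with rfl | hz2
  · refine ⟨![0, 0, x₂, x₃, 0], fun h => ?_, ?_⟩
    · have e0 := congrFun h 2
      have e1 := congrFun h 3
      simp at e0 e1
      simp [e0, e1] at hne2
    · simp [Fin.sum_univ_five]
      linear_combination e2
  refine ⟨![x₀ * z₂ * u, x₁ * z₂ * u, x₂ * z₁ * v, x₃ * z₁ * v, z₁ * z₂ * w], fun h => ?_, ?_⟩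
  · have f0 := congrFun h 0
    have f1 := congrFun h 1
    have f2 := congrFun h 2
    have f3 := congrFun h 3
    have f4 := congrFun h 4
    simp [hz1, hz2] at f0 f1 f2 f3 f4
    subst f4
    have hu : u = 0 := by
      by_contra hu
      have g0 : x₀ = 0 := f0.resolve_right hu
      have g1 : x₁ = 0 := f1.resolve_right hu
      subst g0 g1
      have : t * z₁ ^ 2 = 0 := by rw [← e1]; ring
      simp [ht, hz1] at this
    have hv : v = 0 := by
      by_contra hv
      have g0 : x₂ = 0 := f2.resolve_right hv
      have g1 : x₃ = 0 := f3.resolve_right hv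
      subst g0 g1
      have : s * z₂ ^ 2 = 0 := by rw [← e2]; ring
      simp [hs, hz2] at this
    simp [hu, hv] at hne3
  · simp [Fin.sum_univ_five]
    linear_combination (z₂ * u) ^ 2 * e1 + (z₁ * v) ^ 2 * e2 + (z₁ * z₂) ^ 2 * e3

end HilbertSymbol

/-! ### Positive definite forms, projections and Hermite's inequality. -/

namespace LatticeReduction

open Matrix

/-- An integral vector that is not a proper multiple of another one. -/
def IsPrimitiveVec {m : ℕ} (v : Fin m → ℤ) : Prop := ∀ (d : ℤ) (w : Fin m → ℤ), v = d • w → IsUnit d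

theorem IsPrimitiveVec.ne_zero {m : ℕ} {v : Fin m → ℤ} (hv : IsPrimitiveVec v) : v ≠ 0 := by
  rintro rfl
  exact not_isUnit_zero (hv 0 0 (by simp))

/-- A primitive vector is the first column of a unimodular matrix. -/
theorem IsPrimitiveVec.exists_unimodular {m : ℕ} {v : Fin (m + 1) → ℤ} (hv : IsPrimitiveVec v) :
    ∃ U : Matrix (Fin (m + 1)) (Fin (m + 1)) ℤ, U.det ^ 2 = 1 ∧ ∀ i, U i 0 = v i := by
  -- Smith normal form of `ℤ v` exhibits `v` as a multiple of a basis vector; by primitivity the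
  -- factor is a unit and can be absorbed into the basis.
  obtain ⟨n, bM, bN, f, a, snf⟩ :=
    Submodule.smithNormalForm (Pi.basisFun ℤ (Fin (m + 1))) (Submodule.span ℤ {v})
  have hn : n = 1 := by
    have h1 := Module.finrank_eq_card_basis bN
    rw [← (LinearEquiv.toSpanNonzeroSingleton ℤ (Fin (m + 1) → ℤ) v hv.ne_zero).finrank_eq,
      Module.finrank_self, Fintype.card_fin] at h1
    exact h1.symm
  subst hn
  have hmem : v ∈ Submodule.span ℤ {v} := Submodule.mem_span_singleton_self v
  have h1 := bN.sum_repr ⟨v, hmem⟩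
  rw [Fin.sum_univ_one] at h1
  set c := bN.repr ⟨v, hmem⟩ 0
  have h2 : v = (c * a 0) • bM (f 0) := by
    have := congrArg Subtype.val h1
    rw [mul_smul, ← snf 0]
    exact this.symm
  obtain ⟨u, hu⟩ := hv _ _ h2
  let b := (bM.reindex (Equiv.swap (f 0) 0)).unitsSMul (fun _ => u)
  have hb0 : b 0 = v := by
    simp only [b, Module.Basis.unitsSMul_apply, Module.Basis.reindex_apply, Equiv.symm_swap,
      Equiv.swap_apply_right]
    rw [h2, ← hu]; rfl
  refine ⟨(Pi.basisFun ℤ (Fin (m + 1))).toMatrix b, ?_, fun i => ?_⟩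
  · have := (Pi.basisFun ℤ (Fin (m + 1))).invertibleToMatrix b
    exact Int.isUnit_sq (Matrix.isUnit_det_of_invertible _)
  · rw [Module.Basis.toMatrix_apply, hb0]; simp

/-- The quadratic form of a rational matrix. -/
def quad {m : ℕ} (G : Matrix (Fin m) (Fin m) ℚ) (x : Fin m → ℚ) : ℚ := x ⬝ᵥ G *ᵥ x

/-- Symmetric positive definite rational matrices. -/
structure IsPos {m : ℕ} (G : Matrix (Fin m) (Fin m) ℚ) : Prop where
  symm : ∀ i j, G i j = G j i
  pos : ∀ x, x ≠ 0 → 0 < quad G x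

/-- An integral vector as a rational vector. -/
def toRat {m : ℕ} (x : Fin m → ℤ) : Fin m → ℚ := fun i => x i

theorem toRat_ne_zero {m : ℕ} {x : Fin m → ℤ} (h : x ≠ 0) : toRat x ≠ 0 := by
  intro h'
  apply h
  ext i
  have := congrFun h' i
  simpa [toRat] using this

theorem quad_smul {m : ℕ} (G : Matrix (Fin m) (Fin m) ℚ) (c : ℚ) (x : Fin m → ℚ) :
    quad G (c • x) = c ^ 2 * quad G x := by
  simp only [quad, mulVec_smul, smul_dotProduct, dotProduct_smul, smul_eq_mul]; ring

theorem IsPos.bilin_comm {m : ℕ} {G : Matrix (Fin m) (Fin m) ℚ} (hG : IsPos G) (x y : Fin m → ℚ) :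
    x ⬝ᵥ G *ᵥ y = y ⬝ᵥ G *ᵥ x := by
  have h : Gᵀ = G := by ext i j; exact hG.symm j i
  rw [dotProduct_mulVec, ← mulVec_transpose, h, dotProduct_comm]

theorem IsPos.quad_add {m : ℕ} {G : Matrix (Fin m) (Fin m) ℚ} (hG : IsPos G) (x y : Fin m → ℚ) :
    quad G (x + y) = quad G x + 2 * (x ⬝ᵥ G *ᵥ y) + quad G y := by
  simp only [quad, mulVec_add, add_dotProduct, dotProduct_add]
  rw [hG.bilin_comm y x]; ring

theorem dotProduct_conj_mulVec {m : ℕ} (G W : Matrix (Fin m) (Fin m) ℚ) (z z' : Fin m → ℚ) :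
    z ⬝ᵥ (Wᵀ * G * W) *ᵥ z' = (W *ᵥ z) ⬝ᵥ G *ᵥ (W *ᵥ z') := by
  rw [← mulVec_mulVec, ← mulVec_mulVec, dotProduct_mulVec, vecMul_transpose]

theorem IsPos.conj {m : ℕ} {G W : Matrix (Fin m) (Fin m) ℚ} (hG : IsPos G) (hW : W.det ≠ 0) :
    IsPos (Wᵀ * G * W) := by
  have hGt : Gᵀ = G := by ext i j; exact hG.symm j i
  refine ⟨fun i j => ?_, fun x hx => ?_⟩
  · have : (Wᵀ * G * W)ᵀ = Wᵀ * G * W := by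
      rw [transpose_mul, transpose_mul, transpose_transpose, hGt, Matrix.mul_assoc]
    exact congrFun (congrFun this j) i
  · rw [quad, dotProduct_conj_mulVec]
    exact hG.pos _ fun h => hx (eq_zero_of_mulVec_eq_zero hW h)

theorem map_cast_mulVec_toRat {m : ℕ} (U : Matrix (Fin m) (Fin m) ℤ) (z : Fin m → ℤ) :
    U.map (Int.cast : ℤ → ℚ) *ᵥ toRat z = toRat (U *ᵥ z) := by
  ext i
  simp [toRat, mulVec, dotProduct]

theorem det_map_cast {m : ℕ} (U : Matrix (Fin m) (Fin m) ℤ) :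
    (U.map (Int.cast : ℤ → ℚ)).det = (U.det : ℚ) := (Int.cast_det (R := ℚ) U).symm

/-- The Schur complement of the upper left entry. -/
def schur {m : ℕ} (G : Matrix (Fin (m + 1)) (Fin (m + 1)) ℚ) : Matrix (Fin m) (Fin m) ℚ :=
  of fun i j => G i.succ j.succ - G i.succ 0 * G 0 j.succ / G 0 0

theorem det_eq_mul_det_schur {m : ℕ} (G : Matrix (Fin (m + 1)) (Fin (m + 1)) ℚ) (h : G 0 0 ≠ 0) :
    G.det = G 0 0 * (schur G).det := by
  let H : Matrix (Fin (m + 1)) (Fin (m + 1)) ℚ :=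
    of fun i j => G i j - (if i = 0 then 0 else G i 0 / G 0 0) * G 0 j
  have h1 : H.det = G.det := by
    refine (det_eq_of_forall_row_eq_smul_add_const
      (fun i => if i = 0 then 0 else G i 0 / G 0 0) 0 (by simp) fun i j => ?_).symm
    simp [H]
  rw [← h1, det_succ_column_zero, Fin.sum_univ_succ, Finset.sum_eq_zero]
  · have : H.submatrix (Fin.succAbove 0) Fin.succ = schur G := by
      ext i j
      simp [H, schur]; ring
    rw [this]
    simp [H]
  · intro i _
    have : H i.succ 0 = 0 := by simp [H, h]
    rw [this]; ring

/-- Completing the square in the first variable. -/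
theorem quad_cons {m : ℕ} (G : Matrix (Fin (m + 1)) (Fin (m + 1)) ℚ) (hG : ∀ i j, G i j = G j i)
    (h : G 0 0 ≠ 0) (z : ℚ) (y : Fin m → ℚ) :
    quad G (Fin.cons z y) =
      quad (schur G) y + (G 0 0 * z + ∑ j, G 0 j.succ * y j) ^ 2 / G 0 0 := by
  set L := ∑ j, G 0 j.succ * y j with hL
  have h1 : ∑ i : Fin m, y i * (G i.succ 0 * z) = z * L := by
    rw [hL, Finset.mul_sum]
    exact Finset.sum_congr rfl fun i _ => by rw [hG i.succ 0]; ring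
  have h2 : ∑ i : Fin m, y i * ∑ j, G i.succ 0 * G 0 j.succ / G 0 0 * y j = L ^ 2 / G 0 0 := by
    have : ∀ i : Fin m, y i * ∑ j, G i.succ 0 * G 0 j.succ / G 0 0 * y j =
        G 0 i.succ * y i * (L / G 0 0) := by
      intro i
      have e : ∑ j, G i.succ 0 * G 0 j.succ / G 0 0 * y j = G i.succ 0 / G 0 0 * L := by
        rw [hL, Finset.mul_sum]
        exact Finset.sum_congr rfl fun j _ => by ring
      rw [e, hG i.succ 0]; ring
    rw [Finset.sum_congr rfl fun i _ => this i, ← Finset.sum_mul, ← hL]; ring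
  simp only [quad, dotProduct, mulVec, Fin.sum_univ_succ, Fin.cons_zero, Fin.cons_succ, schur,
    of_apply, sub_mul, mul_add, Finset.sum_sub_distrib, mul_sub, Finset.sum_add_distrib]
  rw [h1, h2, ← hL]
  field_simp
  ring

theorem IsPos.apply_zero_pos {m : ℕ} {G : Matrix (Fin (m + 1)) (Fin (m + 1)) ℚ} (hG : IsPos G) :
    0 < G 0 0 := by
  have := hG.pos (Pi.single 0 1) (by simp)
  simpa [quad] using this

/-- The Schur complement is the minimum of the form over a real-valued first coordinate; that
minimum is attained at a rational point. -/
theorem IsPos.schur {m : ℕ} {G : Matrix (Fin (m + 1)) (Fin (m + 1)) ℚ} (hG : IsPos G) :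
    IsPos (schur G) := by
  have h0 := hG.apply_zero_pos
  refine ⟨fun i j => ?_, fun y hy => ?_⟩
  · simp only [LatticeReduction.schur, of_apply]
    rw [hG.symm i.succ j.succ, hG.symm i.succ 0, hG.symm 0 j.succ]; ring
  · have h1 := quad_cons G hG.symm h0.ne' (-(∑ j, G 0 j.succ * y j) / G 0 0) y
    rw [show G 0 0 * (-(∑ j, G 0 j.succ * y j) / G 0 0) + ∑ j, G 0 j.succ * y j = 0 by
      field_simp; ring] at h1
    have h2 := hG.pos (Fin.cons (-(∑ j, G 0 j.succ * y j) / G 0 0) y) (fun h => hy (by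
      ext i; simpa using congrFun h i.succ))
    rw [h1] at h2
    simpa using h2

/-- Orthogonal projection of the lattice `ℤ^(m+1)` along a primitive vector. -/
theorem IsPos.exists_projection {m : ℕ} {G : Matrix (Fin (m + 1)) (Fin (m + 1)) ℚ} (hG : IsPos G)
    {v : Fin (m + 1) → ℤ} (hv : IsPrimitiveVec v) :
    ∃ G' : Matrix (Fin m) (Fin m) ℚ, IsPos G' ∧ G.det = quad G (toRat v) * G'.det ∧
      ∀ y : Fin m → ℤ, y ≠ 0 → ∃ x : Fin (m + 1) → ℤ, (∀ k j : ℤ, k • x = j • v → k = 0) ∧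
        quad G' (toRat y) = quad G (toRat x) -
          (toRat v ⬝ᵥ G *ᵥ toRat x) ^ 2 / quad G (toRat v) := by
  obtain ⟨U, hU, hUv⟩ := hv.exists_unimodular
  set W : Matrix (Fin (m + 1)) (Fin (m + 1)) ℚ := U.map (Int.cast : ℤ → ℚ) with hW
  have hWdet : W.det ^ 2 = 1 := by
    rw [hW, det_map_cast]; exact_mod_cast hU
  have hW0 : W.det ≠ 0 := by rintro h; rw [h] at hWdet; norm_num at hWdet
  set G₁ := Wᵀ * G * W with hG₁
  have hb : ∀ z z' : Fin (m + 1) → ℚ, z ⬝ᵥ G₁ *ᵥ z' = (W *ᵥ z) ⬝ᵥ G *ᵥ (W *ᵥ z') :=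
    dotProduct_conj_mulVec G W
  have hpos₁ : IsPos G₁ := hG.conj hW0
  have hWU : ∀ z : Fin (m + 1) → ℤ, W *ᵥ toRat z = toRat (U *ᵥ z) := map_cast_mulVec_toRat U
  have hsingle : W *ᵥ Pi.single 0 1 = toRat v := by
    ext i
    simp [hW, toRat, hUv]
  have h00 : G₁ 0 0 = quad G (toRat v) := by
    have := hb (Pi.single 0 1) (Pi.single 0 1)
    rw [hsingle] at this
    simpa [quad] using this
  have h0 := hpos₁.apply_zero_pos
  -- With `v` as first basis vector, projecting along it is taking the Schur complement, and `y`
  -- lifts to `(0, y)` in the new coordinates.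
  refine ⟨LatticeReduction.schur G₁, hpos₁.schur, ?_, fun y hy => ⟨U *ᵥ Fin.cons 0 y, ?_, ?_⟩⟩
  · rw [← h00, ← det_eq_mul_det_schur G₁ h0.ne', hG₁, det_mul, det_mul, det_transpose]
    linear_combination (-G.det) * hWdet
  · intro k j hkj
    have h1 : W *ᵥ (k • toRat (Fin.cons 0 y) - j • Pi.single 0 1) = 0 := by
      rw [mulVec_sub, mulVec_smul, mulVec_smul, hWU, hsingle]
      ext i
      have := congrFun hkj i
      simp only [Pi.smul_apply, smul_eq_mul] at this
      rw [Pi.sub_apply, Pi.smul_apply, Pi.smul_apply, zsmul_eq_mul, zsmul_eq_mul, Pi.zero_apply,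
        sub_eq_zero, toRat, toRat]
      exact_mod_cast this
    by_contra hk
    apply hy
    ext i
    have h2 := congrFun (eq_zero_of_mulVec_eq_zero hW0 h1) i.succ
    simpa [toRat, hk] using h2
  · have h1 := quad_cons G₁ hpos₁.symm h0.ne' 0 (toRat y)
    have h2 : (Fin.cons 0 (toRat y) : Fin (m + 1) → ℚ) = toRat (Fin.cons 0 y) := by
      ext i
      refine Fin.cases ?_ (fun j => ?_) i <;> simp [toRat]
    have h3 : toRat v ⬝ᵥ G *ᵥ toRat (U *ᵥ Fin.cons 0 y) = ∑ j, G₁ 0 j.succ * toRat y j := by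
      rw [← hWU, ← hsingle, ← hb, ← h2, single_one_dotProduct, mulVec, dotProduct,
        Fin.sum_univ_succ]
      simp
    rw [h3, ← h00]
    rw [h2, quad, hb, hWU, mul_zero, zero_add] at h1
    have h4 : quad G (toRat (U *ᵥ Fin.cons 0 y)) = _ := h1
    rw [h4]; ring

theorem exists_common_denominator {m : ℕ} (G : Matrix (Fin m) (Fin m) ℚ) :
    ∃ (d : ℚ) (Z : Matrix (Fin m) (Fin m) ℤ), 0 < d ∧ ∀ i j, d * G i j = Z i j := by
  set d : ℕ := ∏ i, ∏ j, (G i j).den with hd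
  have hpos : 0 < d := Finset.prod_pos fun i _ => Finset.prod_pos fun j _ => (G i j).den_pos
  have hex : ∀ i j, ∃ z : ℤ, (d : ℚ) * G i j = z := by
    intro i j
    obtain ⟨k, hk⟩ : (G i j).den ∣ d :=
      (Finset.dvd_prod_of_mem (fun j => (G i j).den) (Finset.mem_univ j)).trans
        (Finset.dvd_prod_of_mem (fun i => ∏ j, (G i j).den) (Finset.mem_univ i))
    refine ⟨k * (G i j).num, ?_⟩
    rw [hk]
    push_cast
    rw [← Rat.mul_den_eq_num (G i j)]
    ring
  choose Z hZ using hex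
  exact ⟨d, of Z, by exact_mod_cast hpos, hZ⟩

/-- A positive definite form attains its minimum on the nonzero integral vectors. -/
theorem IsPos.exists_min {m : ℕ} {G : Matrix (Fin (m + 1)) (Fin (m + 1)) ℚ} (hG : IsPos G) :
    ∃ v : Fin (m + 1) → ℤ, v ≠ 0 ∧
      ∀ x : Fin (m + 1) → ℤ, x ≠ 0 → quad G (toRat v) ≤ quad G (toRat x) := by
  obtain ⟨d, Z, hd, hZ⟩ := exists_common_denominator G
  have hval : ∀ x : Fin (m + 1) → ℤ, d * quad G (toRat x) = (x ⬝ᵥ Z *ᵥ x : ℤ) := by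
    intro x
    simp only [quad, dotProduct, mulVec, Finset.mul_sum, toRat]
    push_cast
    refine Finset.sum_congr rfl fun i _ => Finset.sum_congr rfl fun j _ => ?_
    rw [← hZ i j]; ring
  have hne : {x : Fin (m + 1) → ℤ | x ≠ 0}.Nonempty := ⟨Pi.single 0 1, by simp⟩
  -- After clearing denominators the values are natural numbers, so well-ordering replaces
  -- compactness.
  let f : (Fin (m + 1) → ℤ) → ℕ := fun x => (x ⬝ᵥ Z *ᵥ x).toNat
  refine ⟨Function.argminOn f _ hne, Function.argminOn_mem f _ hne, fun x hx => ?_⟩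
  have h1 : f (Function.argminOn f _ hne) ≤ f x := Function.argminOn_le f _ hx
  have h2 : ∀ y : Fin (m + 1) → ℤ, y ≠ 0 → d * quad G (toRat y) = (f y : ℚ) := by
    intro y hy
    have h3 : (0 : ℚ) < (y ⬝ᵥ Z *ᵥ y : ℤ) := by
      rw [← hval]; exact mul_pos hd (hG.pos _ (toRat_ne_zero hy))
    have h4 : ((f y : ℕ) : ℤ) = y ⬝ᵥ Z *ᵥ y := Int.toNat_of_nonneg (by exact_mod_cast h3.le)
    rw [hval, ← h4]; simp
  refine le_of_mul_le_mul_left ?_ hd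
  rw [h2 x hx, h2 _ (Function.argminOn_mem f _ hne)]
  exact_mod_cast h1

/-- Adding a suitable multiple of `v` makes the component along `v` small. -/
theorem IsPos.exists_quad_add_smul_le {m : ℕ} {G : Matrix (Fin m) (Fin m) ℚ} (hG : IsPos G)
    {v : Fin m → ℤ} (hv : v ≠ 0) (x : Fin m → ℤ) :
    ∃ k : ℤ, quad G (toRat (x + k • v)) ≤ quad G (toRat x) -
      (toRat v ⬝ᵥ G *ᵥ toRat x) ^ 2 / quad G (toRat v) + quad G (toRat v) / 4 := by
  have hpos := hG.pos _ (toRat_ne_zero hv)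
  set q := quad G (toRat v) with hq
  set b := toRat v ⬝ᵥ G *ᵥ toRat x with hb
  -- Rounding leaves a component along `v` of at most half of `v`, which costs `q / 4`.
  refine ⟨round (-b / q), ?_⟩
  set k := round (-b / q)
  have h1 := abs_le.mp (abs_sub_round (-b / q))
  have h2 : toRat (x + k • v) = toRat x + (k : ℚ) • toRat v := by
    ext i; simp [toRat]
  have h3 : toRat x ⬝ᵥ G *ᵥ ((k : ℚ) • toRat v) = k * b := by
    rw [mulVec_smul, dotProduct_smul, hG.bilin_comm, smul_eq_mul]
  rw [h2, hG.quad_add, h3, quad_smul, ← hq]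
  have h4 : (-b / q - k) ^ 2 ≤ 1 / 4 := by nlinarith
  have h5 : quad G (toRat x) + 2 * (k * b) + (k : ℚ) ^ 2 * q =
      quad G (toRat x) - b ^ 2 / q + (-b / q - k) ^ 2 * q := by
    field_simp; ring
  rw [h5]
  nlinarith

/-- Hermite's lower bound for the determinant in terms of the minimum. -/
theorem IsPos.hermite_le_det (m : ℕ) {G : Matrix (Fin m) (Fin m) ℚ} (hG : IsPos G) {μ : ℚ}
    (hμ : 0 ≤ μ) (h : ∀ x : Fin m → ℤ, x ≠ 0 → μ ≤ quad G (toRat x)) :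
    (3 / 4) ^ (∑ i ∈ Finset.range m, i) * μ ^ m ≤ G.det := by
  induction m generalizing μ with
  | zero => simp
  | succ m ih =>
    obtain ⟨v, hv0, hvmin⟩ := hG.exists_min
    have hq := hG.pos _ (toRat_ne_zero hv0)
    have hv : IsPrimitiveVec v := by
      rintro d w rfl
      have hw : w ≠ 0 := by rintro rfl; simp at hv0
      have hd : d ≠ 0 := by rintro rfl; simp at hv0
      have h1 := hvmin w hw
      have h2 : toRat (d • w) = (d : ℚ) • toRat w := by ext i; simp [toRat]
      rw [h2, quad_smul] at h1
      have h3 := hG.pos _ (toRat_ne_zero hw)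
      have h4 : (d : ℚ) ^ 2 ≤ 1 := by
        by_contra! h4
        nlinarith
      have h5 : d ^ 2 ≤ 1 := by exact_mod_cast h4
      rw [Int.isUnit_iff_abs_eq]
      exact le_antisymm (sq_le_one_iff_abs_le_one d |>.mp h5) (Int.one_le_abs hd)
    obtain ⟨G', hG', hdet, hproj⟩ := hG.exists_projection hv
    set q := quad G (toRat v) with hqdef
    -- A size-reduced lift has value at least `q`, and its component along `v` accounts for at most
    -- `q / 4`. Each projection thus keeps `3 / 4` of the minimum.
    have h1 : ∀ y : Fin m → ℤ, y ≠ 0 → 3 / 4 * q ≤ quad G' (toRat y) := by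
      intro y hy
      obtain ⟨x, hx, hxy⟩ := hproj y hy
      obtain ⟨k, hk⟩ := hG.exists_quad_add_smul_le hv0 x
      have h2 := hvmin (x + k • v) fun h0 => by
        have := hx 1 (-k) (by rw [one_smul, neg_smul]; exact eq_neg_of_add_eq_zero_left h0)
        exact one_ne_zero this
      rw [← hxy, ← hqdef] at hk
      linarith
    have h2 := ih hG' (by positivity) h1
    have h3 : μ ≤ q := h v hv0
    rw [hdet, Finset.sum_range_succ, pow_add]
    calc (3 / 4) ^ (∑ i ∈ Finset.range m, i) * (3 / 4) ^ m * μ ^ (m + 1)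
        ≤ (3 / 4) ^ (∑ i ∈ Finset.range m, i) * (3 / 4) ^ m * q ^ (m + 1) := by gcongr
      _ = q * ((3 / 4) ^ (∑ i ∈ Finset.range m, i) * (3 / 4 * q) ^ m) := by
        rw [mul_pow]; ring
      _ ≤ q * G'.det := by gcongr

/-! ### The even sublattice and reflections of a minimal zero. -/

/-- A basis of a sublattice of index at most two on which a linear form takes even values. -/
theorem exists_even_sublattice {m : ℕ} (c a : Fin m → ℤ) (ha : 2 ∣ ∑ i, c i * a i) :
    ∃ W : Matrix (Fin m) (Fin m) ℤ, W.det ≠ 0 ∧ W.det ^ 2 ≤ 4 ∧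
      (∀ y : Fin m → ℤ, 2 ∣ ∑ i, c i * (W *ᵥ y) i) ∧ ∃ y, W *ᵥ y = a := by
  by_cases hc : ∀ i, 2 ∣ c i
  · exact ⟨1, by simp, by simp, fun y => Finset.dvd_sum fun i _ => (hc i).mul_right _, a, by simp⟩
  push Not at hc
  obtain ⟨i₀, hi⟩ := hc
  -- Coordinate `i₀`, where `c` is odd, becomes `2 y i₀ + ∑ c i y i` over the other `i`, which has
  -- the parity needed to make the linear form even.
  set b : Fin m → ℤ := Function.update c i₀ 2 with hb
  set W : Matrix (Fin m) (Fin m) ℤ := updateRow 1 i₀ b with hW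
  have hdet : W.det = 2 := by
    rw [hW, ← cramer_transpose_apply, transpose_one, cramer_one]
    simp [hb]
  have hsplit : ∀ g f : Fin m → ℤ, ∑ i, g i * f i =
      g i₀ * f i₀ + ∑ i ∈ Finset.univ.erase i₀, g i * f i := fun g f =>
    (Finset.add_sum_erase _ _ (Finset.mem_univ i₀)).symm
  have hne : ∀ (y : Fin m → ℤ) (j : Fin m), j ≠ i₀ → (W *ᵥ y) j = y j := by
    intro y j hj
    rw [mulVec, hW, updateRow_ne hj]
    exact congrFun (one_mulVec y) j
  have heq : ∀ y : Fin m → ℤ,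
      (W *ᵥ y) i₀ = 2 * y i₀ + ∑ i ∈ Finset.univ.erase i₀, c i * y i := by
    intro y
    rw [mulVec, hW, updateRow_self, dotProduct, hsplit]
    congr 1
    · simp [hb]
    · exact Finset.sum_congr rfl fun i h => by rw [hb, Function.update_of_ne (Finset.ne_of_mem_erase h)]
  obtain ⟨e, he⟩ : ∃ e, c i₀ = 2 * e + 1 := ⟨c i₀ / 2, by omega⟩
  refine ⟨W, by rw [hdet]; norm_num, by rw [hdet]; norm_num, fun y => ?_, ?_⟩
  · have hs : ∑ i ∈ Finset.univ.erase i₀, c i * (W *ᵥ y) i =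
        ∑ i ∈ Finset.univ.erase i₀, c i * y i :=
      Finset.sum_congr rfl fun i h => by rw [hne y i (Finset.ne_of_mem_erase h)]
    rw [hsplit, heq, hs, he]
    exact ⟨(2 * e + 1) * y i₀ + (e + 1) * ∑ i ∈ Finset.univ.erase i₀, c i * y i, by ring⟩
  · rw [hsplit, he] at ha
    obtain ⟨r, hr⟩ : ∃ r, a i₀ = 2 * r + ∑ i ∈ Finset.univ.erase i₀, c i * a i := by
      obtain ⟨s, hs⟩ := ha
      exact ⟨s - e * a i₀ - ∑ i ∈ Finset.univ.erase i₀, c i * a i, by linear_combination hs⟩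
    refine ⟨Function.update a i₀ r, ?_⟩
    ext j
    rcases eq_or_ne j i₀ with rfl | hj
    · rw [heq, Function.update_self, hr, Finset.sum_congr rfl fun i h => by
        rw [Function.update_of_ne (Finset.ne_of_mem_erase h)]]
    · rw [hne _ _ hj, Function.update_of_ne hj]

section Reflection

variable {ι : Type*} [Fintype ι]

theorem sq_bilin_le (d a x : ι → ℚ) (hd : ∀ i, 0 ≤ d i) :
    (∑ i, d i * a i * x i) ^ 2 ≤ (∑ i, d i * a i ^ 2) * ∑ i, d i * x i ^ 2 :=
  Finset.sum_sq_le_sum_mul_sum_of_sq_le_mul _ (fun i _ => mul_nonneg (hd i) (sq_nonneg _))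
    (fun i _ => mul_nonneg (hd i) (sq_nonneg _)) (fun i _ => by apply le_of_eq; ring)

/-- The size of the reflection of an isotropic vector `a` in `x`, measured in the majorant. -/
theorem reflection_le (c a x : ι → ℚ) (h0 : ∑ i, c i * a i ^ 2 = 0)
    {T p q β b : ℚ} (hT : ∑ i, |c i| * a i ^ 2 = T) (hTpos : 0 < T)
    (hp : ∑ i, |c i| * x i ^ 2 = p) (hq : ∑ i, c i * x i ^ 2 = q)
    (hβ : ∑ i, c i * a i * x i = β) (hb : ∑ i, |c i| * a i * x i = b) :
    0 ≤ p + β ^ 2 / T - b ^ 2 / T ∧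
    q ^ 2 * T - 4 * q * β * b + 4 * β ^ 2 * p ≤ (p + β ^ 2 / T - b ^ 2 / T) ^ 2 * T := by
  -- Cauchy–Schwarz is applied separately to the positive and negative parts of the form, with
  -- weights `|c i| ± c i`; the claimed difference is `T` times the product of the two defects.
  have h1 := sq_bilin_le (fun i => |c i| + c i) a x (fun i => by linarith [neg_abs_le (c i)])
  have h2 := sq_bilin_le (fun i => |c i| - c i) a x (fun i => by linarith [le_abs_self (c i)])
  simp only [add_mul, sub_mul, Finset.sum_add_distrib, Finset.sum_sub_distrib, h0, hT, hp, hq, hβ,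
    hb] at h1 h2
  have h3 : 0 ≤ p + q - (b + β) ^ 2 / T := by
    rw [sub_nonneg, div_le_iff₀ hTpos]; linarith
  have h4 : 0 ≤ p - q - (b - β) ^ 2 / T := by
    rw [sub_nonneg, div_le_iff₀ hTpos]; linarith
  refine ⟨?_, ?_⟩
  · have h5 : 0 ≤ β ^ 2 / T := by positivity
    have h6 : (b + β) ^ 2 / T + (b - β) ^ 2 / T = 2 * (b ^ 2 / T) + 2 * (β ^ 2 / T) := by ring
    linarith
  · have h5 := mul_nonneg hTpos.le (mul_nonneg h3 h4)
    have h6 : (p + β ^ 2 / T - b ^ 2 / T) ^ 2 * T - (q ^ 2 * T - 4 * q * β * b + 4 * β ^ 2 * p) =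
        T * ((p + q - (b + β) ^ 2 / T) * (p - q - (b - β) ^ 2 / T)) := by
      field_simp; ring
    linarith

end Reflection

/-- A vector independent of a minimal isotropic vector `a`, at which the form is even, cannot be
too short modulo `a`. -/
theorem two_le_of_minimal {n : ℕ} {c a x : Fin n → ℤ} (h0 : ∑ i, c i * a i ^ 2 = 0) {T : ℤ}
    (hT : ∑ i, |c i| * a i ^ 2 = T) (hT3 : 3 ≤ T)
    (hmin : ∀ y : Fin n → ℤ, y ≠ 0 → ∑ i, c i * y i ^ 2 = 0 → T ≤ ∑ i, |c i| * y i ^ 2)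
    (hx : ∀ k j : ℤ, k • x = j • a → k = 0) (heven : 2 ∣ ∑ i, c i * x i) :
    (2 : ℚ) ≤ (∑ i, |c i| * x i ^ 2 : ℤ) + ((∑ i, c i * a i * x i : ℤ) : ℚ) ^ 2 / T -
      ((∑ i, |c i| * a i * x i : ℤ) : ℚ) ^ 2 / T := by
  obtain ⟨h, hh⟩ : ∃ h, ∑ i, c i * x i ^ 2 = 2 * h := by
    have h1 : (2 : ℤ) ∣ ∑ i, c i * x i ^ 2 - ∑ i, c i * x i := by
      rw [← Finset.sum_sub_distrib]
      refine Finset.dvd_sum fun i _ => ?_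
      rw [← mul_sub]
      refine Dvd.dvd.mul_left ?_ _
      have : x i ^ 2 - x i = (x i - 1) * (x i - 1 + 1) := by ring
      rw [this]
      exact (Int.even_mul_succ_self (x i - 1)).two_dvd
    have h2 := dvd_add h1 heven
    rwa [sub_add_cancel] at h2
  set p := ∑ i, |c i| * x i ^ 2 with hp
  set β := ∑ i, c i * a i * x i with hβ
  set b := ∑ i, |c i| * a i * x i with hb
  have hTpos : (0 : ℚ) < T := by exact_mod_cast (by omega : 0 < T)
  obtain ⟨hN0, hN⟩ := reflection_le (fun i => (c i : ℚ)) (fun i => (a i : ℚ)) (fun i => (x i : ℚ))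
    (T := T) (p := p) (q := 2 * h) (β := β) (b := b) (by exact_mod_cast h0) (by exact_mod_cast hT)
    hTpos (by rw [hp]; push_cast; rfl) (by exact_mod_cast hh) (by rw [hβ]; push_cast; rfl)
    (by rw [hb]; push_cast; rfl)
  set N : ℚ := p + β ^ 2 / T - b ^ 2 / T with hNdef
  by_contra! hlt
  -- The competing zeros have the form `r a - s x`: generically `h a - β x`, which is `h` times the
  -- reflection of `a` in `x` when `h ≠ 0`, and `x - k a` if that vector vanishes.
  have expand : ∀ (d : Fin n → ℤ) (r s : ℤ), ∑ i, d i * (r * a i - s * x i) ^ 2 =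
      r ^ 2 * ∑ i, d i * a i ^ 2 - 2 * r * s * ∑ i, d i * a i * x i + s ^ 2 * ∑ i, d i * x i ^ 2 := by
    intro d r s
    simp only [Finset.mul_sum, ← Finset.sum_sub_distrib, ← Finset.sum_add_distrib]
    exact Finset.sum_congr rfl fun i _ => by ring
  by_cases ha' : h • a - β • x = 0
  · have hβ0 : β = 0 := hx β h (sub_eq_zero.mp ha').symm
    have ha0 : a ≠ 0 := by
      rintro rfl
      simp at hT
      omega
    have hh0 : h = 0 := by
      rw [hβ0, zero_smul, sub_zero] at ha'
      exact (smul_eq_zero.mp ha').resolve_right ha0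
    rw [hh0, mul_zero] at hh
    -- Here `x` is itself isotropic and orthogonal to `a`, so every `x - k a` is a zero. The best
    -- `k` gives `T ≤ N + T / 4`, and `T ≥ 3` yields `N ≥ 9 / 4`.
    set k := round ((b : ℚ) / T)
    have hne : (fun i => -k * a i - (-1) * x i) ≠ 0 := by
      intro hcon
      have := hx 1 k (by
        ext i
        have := congrFun hcon i
        simp only [Pi.zero_apply] at this
        simp only [Pi.smul_apply, smul_eq_mul]
        linarith)
      exact one_ne_zero this
    have h1 := hmin _ hne (by rw [expand, h0, hh, ← hβ, hβ0]; ring)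
    rw [expand, hT, ← hb, ← hp] at h1
    have h2 : (T : ℚ) ≤ (k : ℚ) ^ 2 * T - 2 * k * b + p := by
      have : (T : ℚ) ≤ ((-k) ^ 2 * T - 2 * -k * -1 * b + (-1) ^ 2 * p : ℤ) := by
        exact_mod_cast h1
      push_cast at this
      linarith
    have h3 := abs_le.mp (abs_sub_round ((b : ℚ) / T))
    have h4 : ((b : ℚ) / T - k) ^ 2 ≤ 1 / 4 := by nlinarith
    have h5 : (k : ℚ) ^ 2 * T - 2 * k * b + p = N + ((b : ℚ) / T - k) ^ 2 * T := by
      rw [hNdef, hβ0]; field_simp; push_cast; ring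
    have h6 : (3 : ℚ) ≤ T := by exact_mod_cast hT3
    nlinarith
  · have h1 := hmin (fun i => h * a i - β * x i) (fun h' => ha' (by
        ext i; exact congrFun h' i)) (by rw [expand, h0, hh, ← hβ]; ring)
    rw [expand, hT, ← hb, ← hp] at h1
    have h2 : (T : ℚ) ≤ (h ^ 2 * T - 2 * h * β * b + β ^ 2 * p : ℤ) := by exact_mod_cast h1
    push_cast at h2
    -- Minimality together with `reflection_le` at `q = 2h` gives `4 T ≤ N² T`, contradicting `N <
    -- 2`.
    have h3 : N ^ 2 < 4 := by nlinarith
    nlinarith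

/-! ### The bound for a minimal zero. -/

theorem det_diagonal_add_vecMulVec {n : ℕ} (d u v : Fin n → ℚ) (hd : ∀ i, d i ≠ 0) :
    (diagonal d + vecMulVec u v).det = (∏ i, d i) * (1 + ∑ i, v i * (u i / d i)) := by
  have h : diagonal d + vecMulVec u v =
      diagonal d * (1 + replicateCol Unit (fun i => u i / d i) * replicateRow Unit v) := by
    rw [mul_add, mul_one, ← vecMulVec_eq]
    congr 1
    ext i j
    rw [diagonal_mul, vecMulVec_apply, vecMulVec_apply]
    field_simp [hd i]
  rw [h, det_mul, det_diagonal, det_one_add_replicateCol_mul_replicateRow]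
  rfl

theorem dotProduct_diagonal_add_vecMulVec {n : ℕ} (d u v x y : Fin n → ℚ) :
    x ⬝ᵥ (diagonal d + vecMulVec u v) *ᵥ y =
      ∑ i, d i * x i * y i + (∑ i, u i * x i) * ∑ i, v i * y i := by
  rw [add_mulVec, dotProduct_add]
  congr 1
  · simp only [dotProduct, mulVec_diagonal]
    exact Finset.sum_congr rfl fun i _ => by ring
  · rw [Finset.sum_mul_sum]
    simp only [dotProduct, mulVec, vecMulVec_apply, Finset.mul_sum]
    exact Finset.sum_congr rfl fun i _ => Finset.sum_congr rfl fun j _ => by ring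

/-- Dividing a zero by `d` divides its majorant by `d ^ 2`. -/
theorem minimal_zero_primitive {n : ℕ} {c a : Fin n → ℤ} (h0 : ∑ i, c i * a i ^ 2 = 0)
    (hpos : 0 < ∑ i, |c i| * a i ^ 2)
    (hmin : ∀ y : Fin n → ℤ, y ≠ 0 → ∑ i, c i * y i ^ 2 = 0 →
      ∑ i, |c i| * a i ^ 2 ≤ ∑ i, |c i| * y i ^ 2) : IsPrimitiveVec a := by
  rintro d w rfl
  have hs : ∀ f : Fin n → ℤ, ∑ i, f i * (d • w) i ^ 2 = d ^ 2 * ∑ i, f i * w i ^ 2 := by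
    intro f
    rw [Finset.mul_sum]
    exact Finset.sum_congr rfl fun i _ => by simp only [Pi.smul_apply, smul_eq_mul]; ring
  rw [hs] at h0 hpos
  have hd : d ≠ 0 := by rintro rfl; simp at hpos
  have hw : w ≠ 0 := by rintro rfl; simp at hpos
  have h1 := hmin w hw ((mul_eq_zero.mp h0).resolve_left (pow_ne_zero 2 hd))
  rw [hs] at h1
  have h2 : 0 < ∑ i, |c i| * w i ^ 2 := by
    rcases (mul_pos_iff.mp hpos) with h | h
    · exact h.2
    · exact absurd h.1 (sq_nonneg d).not_gt
  have h3 : d ^ 2 ≤ 1 := by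
    by_contra! h3
    nlinarith
  rw [Int.isUnit_iff_abs_eq]
  exact le_antisymm ((sq_le_one_iff_abs_le_one d).mp h3) (Int.one_le_abs hd)

/-- A minimal zero of a diagonal form in five variables has majorant at most `4 ∏ |c i|`. -/
theorem minimal_zero_le {c a : Fin 5 → ℤ} (hc : ∀ i, c i ≠ 0)
    (h0 : ∑ i, c i * a i ^ 2 = 0)
    (hmin : ∀ y : Fin 5 → ℤ, y ≠ 0 → ∑ i, c i * y i ^ 2 = 0 →
      ∑ i, |c i| * a i ^ 2 ≤ ∑ i, |c i| * y i ^ 2) :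
    ∑ i, |c i| * a i ^ 2 ≤ 4 * ∏ i, |c i| := by
  by_contra! hlt
  have hD : 0 < ∏ i, |c i| := Finset.prod_pos fun i _ => abs_pos.mpr (hc i)
  obtain ⟨T, hT⟩ : ∃ T, ∑ i, |c i| * a i ^ 2 = T := ⟨_, rfl⟩
  have hprim : IsPrimitiveVec a := minimal_zero_primitive h0 (by linarith) hmin
  rw [hT] at hmin hlt
  have hT0 : 0 < T := by linarith
  have hTq : (0 : ℚ) < T := by exact_mod_cast hT0
  have hTsum : ∑ i, |(c i : ℚ)| * (a i : ℚ) ^ 2 = T := by exact_mod_cast hT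
  have h0q : ∑ i, (c i : ℚ) * (a i : ℚ) ^ 2 = 0 := by exact_mod_cast h0
  have hcq : ∀ i, |(c i : ℚ)| ≠ 0 := fun i => abs_ne_zero.mpr (by exact_mod_cast hc i)
  -- As `x² ≡ x` modulo `2`, the parity of the form is linear; hence `a` lies in the even
  -- sublattice.
  have heven : 2 ∣ ∑ i, c i * a i := by
    have h1 : (2 : ℤ) ∣ ∑ i, c i * a i ^ 2 - ∑ i, c i * a i := by
      rw [← Finset.sum_sub_distrib]
      refine Finset.dvd_sum fun i _ => ?_
      have : c i * a i ^ 2 - c i * a i = c i * ((a i - 1) * (a i - 1 + 1)) := by ring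
      rw [this]
      exact (Int.even_mul_succ_self (a i - 1)).two_dvd.mul_left _
    rwa [h0, zero_sub, dvd_neg] at h1
  obtain ⟨W, hW0, hW4, hWeven, a', ha'⟩ := exists_even_sublattice c a heven
  have hprim' : IsPrimitiveVec a' := by
    rintro d w rfl
    exact hprim d (W *ᵥ w) (by rw [← ha', mulVec_smul])
  set u : Fin 5 → ℚ := fun i => c i * a i / T
  set v : Fin 5 → ℚ := fun i => c i * a i
  -- The majorant plus `(∑ c i a i x i)² / T`. The added term vanishes at `a`, and projecting along
  -- `a` gives exactly the quantity bounded in `two_le_of_minimal`.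
  set G : Matrix (Fin 5) (Fin 5) ℚ := diagonal (fun i => |(c i : ℚ)|) + vecMulVec u v with hG
  have hbil : ∀ x y : Fin 5 → ℚ, x ⬝ᵥ G *ᵥ y =
      ∑ i, |(c i : ℚ)| * x i * y i + (∑ i, c i * a i * x i) / T * ∑ i, c i * a i * y i := by
    intro x y
    rw [hG, dotProduct_diagonal_add_vecMulVec]
    congr 2
    rw [Finset.sum_div]
    exact Finset.sum_congr rfl fun i _ => by simp only [u]; ring
  have hGpos : IsPos G := by
    refine ⟨fun i j => ?_, fun x hx => ?_⟩
    · rw [hG, Matrix.add_apply, Matrix.add_apply, vecMulVec_apply, vecMulVec_apply]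
      congr 1
      · rcases eq_or_ne i j with rfl | h
        · rfl
        · rw [diagonal_apply_ne _ h, diagonal_apply_ne _ h.symm]
      · simp only [u, v]; ring
    · rw [quad, hbil]
      obtain ⟨i, hi⟩ := Function.ne_iff.mp hx
      have h1 : 0 < ∑ i, |(c i : ℚ)| * x i * x i := by
        refine Finset.sum_pos' (fun j _ => ?_) ⟨i, Finset.mem_univ i, ?_⟩
        · rw [mul_assoc]; exact mul_nonneg (abs_nonneg _) (mul_self_nonneg _)
        · rw [mul_assoc]
          exact mul_pos (lt_of_le_of_ne (abs_nonneg _) (hcq i).symm) (mul_self_pos.mpr hi)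
      have h2 : 0 ≤ (∑ i, c i * a i * x i) / T * ∑ i, c i * a i * x i := by
        rw [div_mul_eq_mul_div]
        exact div_nonneg (mul_self_nonneg _) hTq.le
      linarith
  have hGdet : G.det = 2 * ∏ i, |(c i : ℚ)| := by
    rw [hG, det_diagonal_add_vecMulVec _ _ _ hcq]
    -- The rank-one term doubles the determinant, because `∑ c i² a i² / (T |c i|) = T / T`.
    have : ∑ i, v i * (u i / |(c i : ℚ)|) = 1 := by
      rw [← div_self hTq.ne', show (T : ℚ) / T = (∑ i, |(c i : ℚ)| * (a i : ℚ) ^ 2) / T by rw [hTsum],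
        Finset.sum_div]
      refine Finset.sum_congr rfl fun i _ => ?_
      simp only [u, v]
      field_simp [hcq i]
      rw [sq_abs, mul_comm]
    rw [this]; ring
  set W' : Matrix (Fin 5) (Fin 5) ℚ := W.map (Int.cast : ℤ → ℚ) with hW'
  have hW'det : W'.det = W.det := det_map_cast W
  have hpos₂ : IsPos (W'ᵀ * G * W') := hGpos.conj (by rw [hW'det]; exact_mod_cast hW0)
  have hb₂ : ∀ x y : Fin 5 → ℤ, toRat x ⬝ᵥ (W'ᵀ * G * W') *ᵥ toRat y =
      toRat (W *ᵥ x) ⬝ᵥ G *ᵥ toRat (W *ᵥ y) := by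
    intro x y
    rw [dotProduct_conj_mulVec, hW', map_cast_mulVec_toRat, map_cast_mulVec_toRat]
  obtain ⟨G', hG', hdet, hproj⟩ := hpos₂.exists_projection hprim'
  have haa : ∑ i, (c i : ℚ) * a i * a i = 0 := by
    rw [← h0q]; exact Finset.sum_congr rfl fun i _ => by ring
  have hqa : quad (W'ᵀ * G * W') (toRat a') = T := by
    rw [quad, hb₂, ha', hbil, ← hTsum]
    simp only [toRat, haa, mul_zero, add_zero]
    exact Finset.sum_congr rfl fun i _ => by ring
  have hlow : ∀ y : Fin 4 → ℤ, y ≠ 0 → 2 ≤ quad G' (toRat y) := by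
    intro y hy
    obtain ⟨x, hx, hxy⟩ := hproj y hy
    have hx' : ∀ k j : ℤ, k • (W *ᵥ x) = j • a → k = 0 := by
      intro k j hkj
      refine hx k j (sub_eq_zero.mp (eq_zero_of_mulVec_eq_zero hW0 ?_))
      rw [mulVec_sub, mulVec_smul, mulVec_smul, ha', hkj, sub_self]
    refine (two_le_of_minimal h0 hT (by linarith) hmin hx' (hWeven x)).trans_eq ?_
    rw [hxy, hqa, hb₂, quad, hb₂, ha', hbil, hbil]
    simp only [toRat, haa, zero_div, zero_mul, add_zero]
    push_cast
    congr 1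
    rw [sq, div_mul_eq_mul_div]
    congr 1
    exact Finset.sum_congr rfl fun i _ => by ring
  have h1 := hG'.hermite_le_det 4 (by norm_num) hlow
  rw [det_mul, det_mul, det_transpose, hW'det, hGdet, hqa] at hdet
  have h2 : (W.det : ℚ) ^ 2 ≤ 4 := by exact_mod_cast hW4
  have h3 : 4 * ∏ i, |(c i : ℚ)| < T := by exact_mod_cast hlt
  have h4 : 0 < ∏ i, |(c i : ℚ)| := by exact_mod_cast hD
  have h5 : (T : ℚ) * G'.det ≤ 8 * ∏ i, |(c i : ℚ)| := by
    rw [← hdet]; nlinarith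
  -- Hermite gives `G'.det ≥ (3/4)^6 * 2^4 = 729/256`, whereas `T > 4 ∏ |c i|` and `h5` force
  -- `G'.det < 2`.
  simp only [Finset.sum_range_succ, Finset.sum_range_zero] at h1
  norm_num at h1
  nlinarith

/-- A small zero of an indefinite diagonal form in five variables. -/
theorem exists_small_zero_five (c : Fin 5 → ℤ) (hc : ∀ i, c i ≠ 0) (hpos : ∃ i, 0 < c i)
    (hneg : ∃ i, c i < 0) {H : ℤ} (hH : ∀ i, |c i| ≤ H) :
    ∃ x : Fin 5 → ℤ, x ≠ 0 ∧ ∑ i, c i * x i ^ 2 = 0 ∧ ∀ i, x i ^ 2 ≤ 2 * H ^ 4 := by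
  set Z : Set (Fin 5 → ℤ) := {x | x ≠ 0 ∧ ∑ i, c i * x i ^ 2 = 0} with hZ
  have hne : Z.Nonempty := HilbertSymbol.meyer_five c hc hpos hneg
  let f : (Fin 5 → ℤ) → ℕ := fun x => (∑ i, |c i| * x i ^ 2).toNat
  have hf : ∀ x, ((f x : ℕ) : ℤ) = ∑ i, |c i| * x i ^ 2 := fun x =>
    Int.toNat_of_nonneg (Finset.sum_nonneg fun i _ => mul_nonneg (abs_nonneg _) (sq_nonneg _))
  set a := Function.argminOn f Z hne
  obtain ⟨ha0, ha⟩ : a ∈ Z := Function.argminOn_mem f Z hne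
  have hle := minimal_zero_le hc ha fun y hy0 hy => by
    rw [← hf, ← hf]
    exact_mod_cast Function.argminOn_le f Z (show y ∈ Z from ⟨hy0, hy⟩)
  refine ⟨a, ha0, ha, fun i => ?_⟩
  have hci := abs_pos.mpr (hc i)
  -- At a zero the positive and negative parts balance, so each contributes exactly half of the
  -- majorant.
  have h1 : 2 * (|c i| * a i ^ 2) ≤ ∑ i, |c i| * a i ^ 2 := by
    rcases abs_cases (c i) with ⟨h, _⟩ | ⟨h, _⟩
    · have h2 := Finset.single_le_sum (f := fun j => (|c j| + c j) * a j ^ 2)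
        (fun j _ => mul_nonneg (by linarith [neg_abs_le (c j)]) (sq_nonneg _)) (Finset.mem_univ i)
      simp only [add_mul, Finset.sum_add_distrib, ha, add_zero] at h2
      rw [h] at h2 ⊢
      linarith
    · have h2 := Finset.single_le_sum (f := fun j => (|c j| - c j) * a j ^ 2)
        (fun j _ => mul_nonneg (by linarith [le_abs_self (c j)]) (sq_nonneg _)) (Finset.mem_univ i)
      simp only [sub_mul, Finset.sum_sub_distrib, ha, sub_zero] at h2
      rw [h] at h2 ⊢
      linarith
  -- Keeping the factor `|c i|` lets it cancel, leaving four coefficients and hence `H ^ 4`.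
  have h3 : ∏ j, |c j| ≤ |c i| * H ^ 4 := by
    rw [← Finset.mul_prod_erase _ _ (Finset.mem_univ i)]
    refine mul_le_mul_of_nonneg_left ?_ hci.le
    refine (Finset.prod_le_prod (fun j _ => abs_nonneg _) fun j _ => hH j).trans_eq ?_
    simp
  have h4 : |c i| * a i ^ 2 ≤ |c i| * (2 * H ^ 4) := by linarith
  exact le_of_mul_le_mul_left h4 hci

end LatticeReduction

/-! ### Reduction from diagonal matrices to five variables. -/

namespace IntegralForm

open Matrix

theorem toQuadraticForm'_apply_of_isDiag {n : ℕ} {R : Type*} [CommRing R]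
    {A : Matrix (Fin n) (Fin n) R} (h : A.IsDiag) (x : Fin n → R) :
    A.toQuadraticForm' x = ∑ i, A i i * x i ^ 2 := by
  rw [toQuadraticForm', LinearMap.BilinMap.toQuadraticMap_apply, toLinearMap₂'_apply',
    ← h.diagonal_diag]
  simp only [dotProduct, mulVec_diagonal, diagonal_apply_eq, diag_apply]
  exact Finset.sum_congr rfl fun i _ => by ring

theorem Indefinite.exists_pos_neg {n : ℕ} {A : Matrix (Fin n) (Fin n) ℤ} (h : A.IsDiag)
    (hA : Indefinite A) : (∃ i, 0 < A i i) ∧ ∃ i, A i i < 0 := by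
  have hr : ∀ x, realForm A x = ∑ i, (A i i : ℝ) * x i ^ 2 := fun x =>
    toQuadraticForm'_apply_of_isDiag (h.map (by simp)) x
  obtain ⟨⟨x, hx⟩, y, hy⟩ := hA
  rw [hr] at hx hy
  constructor
  · by_contra! hcon
    exact absurd hx (Finset.sum_nonpos fun i _ => mul_nonpos_of_nonpos_of_nonneg
      (by exact_mod_cast hcon i) (sq_nonneg _)).not_gt
  · by_contra! hcon
    exact absurd hy (Finset.sum_nonneg fun i _ => mul_nonneg
      (by exact_mod_cast hcon i) (sq_nonneg _)).not_gt

theorem abs_apply_le_height {n : ℕ} (A : Matrix (Fin n) (Fin n) ℤ) (i j : Fin n) :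
    |A i j| ≤ height A := by
  rw [Int.abs_eq_natAbs]
  exact_mod_cast Finset.le_sup (f := fun p : Fin n × Fin n => (A p.1 p.2).natAbs)
    (Finset.mem_univ (i, j))

/-- Five distinct indices, two of which are prescribed. -/
theorem exists_embedding_five {n : ℕ} (hn : 5 ≤ n) (i j : Fin n) :
    ∃ f : Fin 5 ↪ Fin n, (∃ k, f k = i) ∧ ∃ k, f k = j := by
  obtain ⟨s, hs, hcard⟩ := Finset.exists_superset_card_eq (s := {i, j}) (n := 5)
    (Finset.card_le_two.trans (by norm_num)) (by simpa using hn)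
  have hmem : ∀ k ∈ s, ∃ l, s.orderEmbOfFin hcard l = k := by
    intro k hk
    have : k ∈ Set.range (s.orderEmbOfFin hcard) := by simpa using hk
    exact this
  exact ⟨(s.orderEmbOfFin hcard).toEmbedding, hmem i (hs (by simp)), hmem j (hs (by simp))⟩

theorem exists_small_zero {n : ℕ} (hn : 5 ≤ n) {A : Matrix (Fin n) (Fin n) ℤ} (h : A.IsDiag)
    (hA : Indefinite A) : ∃ x ∈ zeros A, ∀ i, x i ^ 2 ≤ 2 * (height A : ℤ) ^ 4 := by
  have hf : ∀ x, form A x = ∑ i, A i i * x i ^ 2 := toQuadraticForm'_apply_of_isDiag h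
  obtain ⟨⟨i, hi⟩, j, hj⟩ := hA.exists_pos_neg h
  have hH : 1 ≤ (height A : ℤ) := (Int.one_le_abs hi.ne').trans (abs_apply_le_height A i i)
  by_cases h0 : ∃ k, A k k = 0
  · obtain ⟨k, hk⟩ := h0
    refine ⟨Pi.single k 1, ⟨by simp, ?_⟩, fun l => ?_⟩
    · rw [hf]
      refine Finset.sum_eq_zero fun l _ => ?_
      rcases eq_or_ne l k with rfl | hlk
      · simp [hk]
      · simp [hlk]
    · have h1 := one_le_pow₀ hH (n := 4)
      rcases eq_or_ne l k with rfl | hlk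
      · rw [Pi.single_eq_same]; linarith
      · rw [Pi.single_eq_of_ne hlk]; linarith
  · push Not at h0
    obtain ⟨f, ⟨ki, hki⟩, kj, hkj⟩ := exists_embedding_five hn i j
    obtain ⟨y, hy0, hy, hle⟩ := LatticeReduction.exists_small_zero_five (fun k => A (f k) (f k))
      (fun k => h0 _) ⟨ki, by rwa [hki]⟩ ⟨kj, by rwa [hkj]⟩
      (fun k => abs_apply_le_height A (f k) (f k))
    have hext : ∀ k, Function.extend f y 0 (f k) = y k := f.injective.extend_apply y 0
    have hext0 : ∀ l, (¬ ∃ k, f k = l) → Function.extend f y 0 l = 0 := fun l hl => by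
      rw [Function.extend_apply' _ _ _ hl]; rfl
    -- The five-variable zero is extended by zero along the embedding `f`.
    refine ⟨Function.extend f y 0, ⟨fun h' => hy0 ?_, ?_⟩, fun l => ?_⟩
    · ext k
      rw [← hext k, h']; rfl
    · rw [hf, ← hy, ← Finset.sum_map Finset.univ f
        (fun l => A l l * Function.extend f y 0 l ^ 2) |>.trans
        (Finset.sum_congr rfl fun k _ => by rw [hext])]
      refine (Finset.sum_subset (Finset.subset_univ _) fun l _ hl => ?_).symm
      rw [hext0 l (by simpa using hl)]; ring
    · by_cases hl : ∃ k, f k = l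
      · obtain ⟨k, rfl⟩ := hl
        rw [hext]; exact hle k
      · rw [hext0 l hl]; positivity

end IntegralForm

theorem theorem1 (n : ℕ) (hn : 5 ≤ n) (A : Matrix (Fin n) (Fin n) ℤ)
    (hdiag : A.IsDiag) (hindef : IntegralForm.Indefinite A) :
    (∃ x ∈ IntegralForm.zeros A, ‖x‖ ≤ Real.sqrt 2 * (IntegralForm.height A : ℝ) ^ 2) ∧
      IntegralForm.leastZeroBound A ≤ Real.sqrt 2 * (IntegralForm.height A : ℝ) ^ 2 := by
  have hmain : ∃ x ∈ IntegralForm.zeros A,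
      ‖x‖ ≤ Real.sqrt 2 * (IntegralForm.height A : ℝ) ^ 2 := by
    obtain ⟨x, hx, hle⟩ := IntegralForm.exists_small_zero hn hdiag hindef
    refine ⟨x, hx, (pi_norm_le_iff_of_nonneg (by positivity)).mpr fun i => ?_⟩
    rw [Int.norm_eq_abs]
    have h1 : ((x i : ℤ) : ℝ) ^ 2 ≤ 2 * ((IntegralForm.height A : ℝ) ^ 2) ^ 2 := by
      rw [← pow_mul]; exact_mod_cast hle i
    refine (Real.abs_le_sqrt h1).trans_eq ?_
    rw [Real.sqrt_mul (by norm_num), Real.sqrt_sq (by positivity)]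
  exact ⟨hmain, csInf_le ⟨0, fun B hB => hB.1⟩ ⟨by positivity, fun _ => hmain⟩⟩
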